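/- \textbf{Theorem.} There are absolute constants $C,c>0$ such that the following holds for every prime power $q$ and every rational $0<R\le 1$. There is $c'=c'(q,R)>0$ such that for every $\varepsilon>0$ there are integers $s_0,N_0$, depending only on $q,R,\varepsilon$, with the following property. Let $s\ge s_0$ and $N\ge N_0$ be integers such that $K=RN$ is an integer. Let $\mathbb F\supseteq\mathbb F_q$ be a finite field with $|\mathbb F|>sN$ and let $\gamma$ be a primitive element of $\mathbb F$. Let $C_{\rm out}$ be the $s$-folded Reed--Solomon code of block length $N$ and rate $R$, i.e. the set of all words $$\Big(\big(f(\gamma^{si}),f(\gamma^{si+1}),\dots,f(\gamma^{si+s-1})\big)\Big)_{0\le i<N},\qquad f\in\mathbb F[X],\ \deg f<sK.$$ Let $n=s[\mathbb F:\mathbb F_q]$ and fix any $\mathbb F_q$-linear identification of the alphabet $\mathbb F^s$ (which has $q^n$ elements) with the row vectors in $\mathbb F_q^n$. Let $\mathbf G_1,\dots,\mathbf G_N$ be independent, uniformly random $n\times n$ matrices over $\mathbb F_q$ (not required to be invertible), and let $$C^*=\{(u_1\mathbf G_1,\dots,u_N\mathbf G_N):(u_1,\dots,u_N)\in C_{\rm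 out}\}\subseteq\mathbb F_q^{nN}$$ be the concatenated code. Then: 1. with probability at least $1-q^{-c\,nN}$, the code $C^*$ is $\left(1-R-\varepsilon,\ \left(\frac N{\varepsilon^2}\right)^{C\varepsilon^{-2}\log(1/R)}\right)$-list decodable from erasures: for every $y\in(\mathbb F_q\cup\{?\})^{nN}$ with at most $(1-R-\varepsilon)nN$ erased positions (symbols $?$), the number of codewords of $C^*$ that coincide with $y$ at all unerased positions is at most $\left(\frac N{\varepsilon^2}\right)^{C\varepsilon^{-2}\log(1/R)}$; 2. if $R<1$, then with probability at least $1-q^{-c'nN}$ the code $C^*$ has rate $R$, i.e. $|C^*|=q^{R\,nN}$. -/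

import Mathlib

open Polynomial
open scoped Matrix

noncomputable section

/-- The rate `log_|A| |C| / n` of a code `C ⊆ A^n`: it equals `k / n` when `C` has `|A|^k`
elements. The coordinates are indexed by a finite type `ι` with `n` elements. -/
def codeRate {ι A : Type*} [Fintype ι] [Fintype A] (C : Set (ι → A)) : ℝ :=
  Real.logb (Fintype.card A) (C.ncard) / Fintype.card ι

/-- The number of erased positions of an erased received word; `none` is the erasure symbol. -/
def erasureWeight {ι A : Type*} (y : ι → Option A) : ℕ :=
  {i | y i = none}.ncard

/-- The word `c` coincides with the erased received word `y` at every unerased position. -/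
def AgreesWith {ι A : Type*} (c : ι → A) (y : ι → Option A) : Prop :=
  ∀ i, y i ≠ none → y i = some (c i)

/-- `C` is `(ρ, L)`-list decodable from erasures: every erased received word with at most a
fraction `ρ` of erased positions agrees with at most `L` codewords. -/
def ErasureListDecodable {ι A : Type*} [Fintype ι] (ρ : ℝ) (L : ℕ) (C : Set (ι → A)) : Prop :=
  ∀ y : ι → Option A, (erasureWeight y : ℝ) ≤ ρ * Fintype.card ι →
    {c | c ∈ C ∧ AgreesWith c y}.encard ≤ L

/-- The `s`-folded Reed–Solomon encoding of a polynomial `f`: the symbol at position `i` is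
`(f (γ ^ (s i)), f (γ ^ (s i + 1)), …, f (γ ^ (s i + s - 1)))`, an element of `F ^ s`. -/
def foldedRSEncode {F : Type*} [Field F] (γ : F) (s N : ℕ) (f : F[X]) : Fin N → Fin s → F :=
  fun i j => f.eval (γ ^ (s * (i : ℕ) + (j : ℕ)))

/-- The `s`-folded Reed–Solomon code of block length `N` over the alphabet `F ^ s`, with
messages the polynomials over `F` of degree less than `k`. -/
def foldedRSCode {F : Type*} [Field F] (γ : F) (s N k : ℕ) : Set (Fin N → Fin s → F) :=
  foldedRSEncode γ s N '' {f | f.degree < (k : ℕ)}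

/-- Code concatenation with an outer code `Cout` of block length `N` over the alphabet `A` and
inner encoders `E i : A → B ^ n`, one for each outer position. -/
def concatCode {A B : Type*} {N n : ℕ} (Cout : Set (Fin N → A))
    (E : Fin N → A → Fin n → B) : Set (Fin N × Fin n → B) :=
  (fun u p => E p.1 (u p.1) p.2) '' Cout

/-- The inner encoder with generator matrix `G`, where the outer alphabet `A` is identified
with the row vectors in `K ^ k` through the linear isomorphism `φ`. -/
def innerEncoder {K A : Type*} [Field K] [AddCommGroup A] [Module K A] {k n : ℕ}
    (φ : A ≃ₗ[K] (Fin k → K)) (G : Matrix (Fin k) (Fin n) K) : A → Fin n → K :=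
  fun a => φ a ᵥ* G

/-- The probability of the event `E` under the uniform distribution on a finite type. -/
def uniformProb {Ω : Type*} [Finite Ω] (E : Ω → Prop) : ℝ :=
  ({ω | E ω}.ncard : ℝ) / Nat.card Ω

end

/-! Fix a set S of unerased positions of size at least (R+ε)nN. The outer codewords whose encoding
vanishes on S form an F_q-space W, and the words agreeing with a received word lie in a coset of its
image. So it suffices that, with high probability, dim W ≤ rM for every such S, with r and M
depending only on q and ε. The resulting list size q^(rM) is constant, and the stated bound exceeds
it once N is large.

Algebra: folded Reed–Solomon codes are subspace designs. The folded Wronskian of an r-dimensional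
space H of polynomials is nonzero, has low degree, and vanishes to order dim(H ∩ ker) at many points
of each block (`sum_finrank_inf_ker_blockEval_le`). Passing from F to F_q, a space W of dimension at
least rM has rank at most M at no more than about K positions (`card_lowRank_blockEval`). Averaging
over W then gives, for any subspaces P_i of dimension at most J, a word u in W with u_i outside P_i
at all but (R+ε/2)N positions (`exists_card_compl_freshPositions_le`).

Probability: if dim W > rM, one can pick J+1 words of W greedily, each mostly avoiding the spans of
its predecessors. At such fresh blocks the products with the random matrices are independent of the
earlier ones, so each new word costs a factor 1/q per position of S in a fresh block. Few words have
a prescribed fresh set, so a union bound gives a factor q^((J+1)N − εnN/2) per word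
(`ncard_bad_le`). With J+1 ≥ 6/ε and n ≥ (J+1)² this beats the at most 2^(nN) choices of S. The rate
statement is the same union bound for a single nonzero codeword. -/

/-! ### Folded Wronskians and the subspace design property -/

section FoldedWronskian

variable {F : Type*} [Field F]

/-- The folded Wronskian of a tuple of polynomials. -/
noncomputable def foldedWronskian (γ : F) {r : ℕ} (f : Fin r → F[X]) : F[X] :=
  (Matrix.of fun a b : Fin r => (f a).comp (C (γ ^ (b : ℕ)) * X)).det

theorem natDegree_comp_C_mul_X {c : F} (hc : c ≠ 0) (p : F[X]) :
    (p.comp (C c * X)).natDegree = p.natDegree := by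
  rw [natDegree_comp, natDegree_C_mul_X c hc, mul_one]

theorem leadingCoeff_comp_C_mul_X {c : F} (hc : c ≠ 0) (p : F[X]) :
    (p.comp (C c * X)).leadingCoeff = p.leadingCoeff * c ^ p.natDegree := by
  rw [leadingCoeff_comp (by rw [natDegree_C_mul_X c hc]; exact one_ne_zero),
    leadingCoeff_C_mul_X]

/-- The coefficient at the sum of the degrees is the product of the leading coefficients times a
Vandermonde determinant in the γ^deg. These nodes are distinct because the degrees are distinct and
below the order of γ. -/
theorem foldedWronskian_ne_zero {γ : F} {m r : ℕ} (hγ : IsPrimitiveRoot γ m) (hm : γ ≠ 0)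
    {f : Fin r → F[X]} (hf : ∀ a, f a ≠ 0) (hdeg : ∀ a, (f a).natDegree < m)
    (hinj : Function.Injective fun a => (f a).natDegree) : foldedWronskian γ f ≠ 0 := by
  intro h0
  have hpow : ∀ b : ℕ, γ ^ b ≠ 0 := fun b => pow_ne_zero _ hm
  have hc : (foldedWronskian γ f).coeff (∑ a, (f a).natDegree) =
      (Matrix.of fun a b : Fin r =>
        (f a).leadingCoeff * (Matrix.vandermonde fun a => γ ^ (f a).natDegree) a b).det := by
    rw [foldedWronskian, ← Matrix.det_transpose, Matrix.det_apply,
      ← Matrix.det_transpose (Matrix.of fun a b : Fin r => _), Matrix.det_apply, finsetSum_coeff]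
    refine Finset.sum_congr rfl fun σ _ => ?_
    rw [Units.smul_def, Units.smul_def, coeff_smul]
    congr 1
    have hd : (∏ i, (f i).comp (C (γ ^ ((σ i : Fin r) : ℕ)) * X)).natDegree
        = ∑ a, (f a).natDegree := by
      rw [natDegree_prod]
      · exact Finset.sum_congr rfl fun i _ => natDegree_comp_C_mul_X (hpow _) _
      · intro i _ h
        have := leadingCoeff_comp_C_mul_X (hpow (σ i)) (f i)
        rw [h, leadingCoeff_zero] at this
        exact mul_ne_zero (leadingCoeff_ne_zero.2 (hf i)) (pow_ne_zero _ (hpow _)) this.symm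
    simp only [Matrix.transpose_apply, Matrix.of_apply]
    rw [← hd, coeff_natDegree, leadingCoeff_prod]
    refine Finset.prod_congr rfl fun i _ => ?_
    rw [leadingCoeff_comp_C_mul_X (hpow _), Matrix.vandermonde_apply, ← pow_mul, ← pow_mul,
      mul_comm ((σ i : Fin r) : ℕ)]
  rw [h0, coeff_zero, Matrix.det_mul_column] at hc
  refine mul_ne_zero (Finset.prod_ne_zero_iff.2 fun a _ => leadingCoeff_ne_zero.2 (hf a))
    (Matrix.det_vandermonde_ne_zero_iff.2 fun a b hab => hinj ?_) hc.symm
  exact hγ.pow_inj (hdeg a) (hdeg b) hab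

theorem natDegree_foldedWronskian_le (γ : F) {r k : ℕ} {f : Fin r → F[X]}
    (hdeg : ∀ a, (f a).natDegree ≤ k) : (foldedWronskian γ f).natDegree ≤ r * k := by
  rw [foldedWronskian, ← Matrix.det_transpose, Matrix.det_apply]
  refine natDegree_sum_le_of_forall_le _ _ fun σ _ => ?_
  refine (natDegree_smul_le _ _).trans ((natDegree_prod_le _ _).trans ?_)
  calc _ ≤ ∑ _i : Fin r, k := by
        refine Finset.sum_le_sum fun i _ => ?_
        simp only [Matrix.transpose_apply, Matrix.of_apply]
        refine natDegree_comp_le.trans ?_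
        calc _ ≤ k * 1 := Nat.mul_le_mul (hdeg i) (natDegree_C_mul_le _ _ |>.trans natDegree_X_le)
          _ = k := mul_one k
    _ = r * k := by simp

theorem foldedWronskian_linearCombination (γ : F) {r : ℕ} (P : Matrix (Fin r) (Fin r) F)
    (f : Fin r → F[X]) :
    foldedWronskian γ (fun a => ∑ c, P a c • f c) = C P.det * foldedWronskian γ f := by
  rw [foldedWronskian, foldedWronskian, RingHom.map_det, ← Matrix.det_mul]
  congr 1
  ext1 a b
  simp only [Matrix.of_apply, Matrix.mul_apply, RingHom.mapMatrix_apply, Matrix.map_apply]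
  rw [← coe_compRingHom_apply, map_sum]
  exact Finset.sum_congr rfl fun c _ => by rw [coe_compRingHom_apply, smul_comp, smul_eq_C_mul]

theorem pow_card_dvd_det {R ι : Type*} [CommRing R] [Fintype ι] [DecidableEq ι] (p : R)
    (M : Matrix ι ι R) (Z : Finset ι) (h : ∀ a ∈ Z, ∀ b, p ∣ M a b) : p ^ Z.card ∣ M.det := by
  rw [← Matrix.det_transpose, Matrix.det_apply]
  refine Finset.dvd_sum fun σ _ => ?_
  refine dvd_smul_of_dvd _ ?_
  rw [← Finset.prod_const]
  exact (Finset.prod_dvd_prod_of_dvd _ _ fun a ha => h a ha _).trans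
    (Finset.prod_dvd_prod_of_subset _ _ _ (Finset.subset_univ Z))

theorem exists_basis_finset_mem {K E : Type*} [Field K] [AddCommGroup E] [Module K E]
    [FiniteDimensional K E] {r : ℕ} (hr : Module.finrank K E = r) (Q : Submodule K E) :
    ∃ (e : Module.Basis (Fin r) K E) (Z : Finset (Fin r)),
      Z.card = Module.finrank K Q ∧ ∀ a ∈ Z, e a ∈ Q := by
  let v := Module.finBasis K Q
  have hv : LinearIndependent K fun a => (v a : E) :=
    v.linearIndependent.map' Q.subtype (Submodule.ker_subtype Q)
  let e := Module.Basis.sumExtend hv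
  have : Finite (Fin (Module.finrank K Q) ⊕ Module.Basis.sumExtendIndex hv) :=
    Module.Finite.finite_basis e
  let eqv := Finite.equivFinOfCardEq ((Module.finrank_eq_nat_card_basis e).symm.trans hr)
  refine ⟨e.reindex eqv, Finset.univ.map (Function.Embedding.inl.trans eqv.toEmbedding), ?_, ?_⟩
  · simp
  · intro a ha
    obtain ⟨i, -, rfl⟩ := Finset.mem_map.1 ha
    have he : (e.reindex eqv ((Function.Embedding.inl.trans eqv.toEmbedding) i)) = v i := by
      simp only [e, Module.Basis.sumExtend, Module.Basis.reindex_apply, Function.Embedding.trans_apply,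
        Function.Embedding.inl_apply, Equiv.coe_toEmbedding, Equiv.symm_apply_apply,
        Module.Basis.extend_apply_self]
      rfl
    rw [he]
    exact (v i).2

/-- Rewriting `f` in a basis of `H` adapted to `H ⊓ H'` changes the determinant only by a scalar
factor, and each basis element in `H'` gives a row divisible by X − x. -/
theorem X_sub_C_pow_dvd_foldedWronskian (γ x : F) {r : ℕ} (H : Submodule F F[X])
    [FiniteDimensional F H] (hr : Module.finrank F H = r) {f : Fin r → F[X]} (hf : ∀ a, f a ∈ H)
    (H' : Submodule F F[X]) (hH' : ∀ p ∈ H', ∀ b < r, p.eval (γ ^ b * x) = 0) :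
    (X - C x) ^ Module.finrank F (H ⊓ H' : Submodule F F[X]) ∣ foldedWronskian γ f := by
  classical
  obtain ⟨e', Z, hZ, hZmem⟩ :=
    exists_basis_finset_mem (K := F) (E := H) hr ((H ⊓ H').comap H.subtype)
  have hfe : f = fun a => ∑ c, (Matrix.of fun a c => e'.repr ⟨f a, hf a⟩ c) a c • (e' c : F[X]) := by
    funext a
    have := congrArg (Subtype.val) (e'.sum_repr ⟨f a, hf a⟩)
    rw [Submodule.coe_sum] at this
    exact this.symm
  rw [hfe, foldedWronskian_linearCombination,
    ← (Submodule.comapSubtypeEquivOfLe (inf_le_left : H ⊓ H' ≤ H)).finrank_eq, ← hZ]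
  refine Dvd.dvd.mul_left ?_ _
  refine pow_card_dvd_det (X - C x) _ Z fun a ha b => ?_
  rw [Matrix.of_apply, dvd_iff_isRoot, IsRoot, eval_comp]
  have hmem : (e' a : F[X]) ∈ H' := (Submodule.mem_inf.1 (hZmem a ha)).2
  simpa using hH' _ hmem b b.2

/-- A finite-dimensional space of polynomials contains as many polynomials of distinct degrees as
its dimension. -/
theorem exists_injective_natDegree {r : ℕ} (H : Submodule F F[X]) [FiniteDimensional F H]
    (hr : Module.finrank F H = r) :
    ∃ f : Fin r → F[X], (∀ a, f a ∈ H) ∧ (∀ a, f a ≠ 0) ∧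
      Function.Injective fun a => (f a).natDegree := by
  classical
  let S : Set ℕ := {d | ∃ p ∈ H, p ≠ 0 ∧ p.natDegree = d}
  have key : ∃ T : Finset ℕ, (T : Set ℕ) ⊆ S ∧ T.card = r := by
    by_contra hcon
    have hfin : S.Finite := by
      by_contra hinf
      obtain ⟨T, h1, h2⟩ := Set.Infinite.exists_subset_card_eq hinf r
      exact hcon ⟨T, h1, h2⟩
    have hlt : hfin.toFinset.card < r := by
      by_contra hge
      obtain ⟨T, h1, h2⟩ := Finset.exists_subset_card_eq (not_lt.1 hge)
      exact hcon ⟨T, fun x hx => hfin.mem_toFinset.1 (h1 hx), h2⟩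
    -- Reading off only the coefficients at degrees occurring in `H` is injective, since the leading
    -- coefficient of a nonzero element is among them.
    let φ : H →ₗ[F] (hfin.toFinset → F) :=
      LinearMap.pi fun d => (lcoeff F (d : ℕ)).comp H.subtype
    have hφ : Function.Injective φ := by
      rw [← LinearMap.ker_eq_bot, LinearMap.ker_eq_bot']
      intro p hp
      by_contra hne
      have hne' : (p : F[X]) ≠ 0 := fun h => hne (Subtype.ext h)
      have := congrFun hp ⟨(p : F[X]).natDegree, hfin.mem_toFinset.2 ⟨p, p.2, hne', rfl⟩⟩
      exact hne' (leadingCoeff_eq_zero.1 this)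
    have := LinearMap.finrank_le_finrank_of_injective hφ
    rw [hr, Module.finrank_fintype_fun_eq_card, Fintype.card_coe] at this
    omega
  obtain ⟨T, hTS, hT⟩ := key
  choose p hpH hp0 hpd using fun d : T => hTS d.2
  let e := T.equivFinOfCardEq hT
  refine ⟨fun a => p (e.symm a), fun a => hpH (e.symm a), fun a => hp0 (e.symm a), ?_⟩
  intro a b hab
  simp only at hab
  rw [hpd (e.symm a), hpd (e.symm b)] at hab
  exact e.symm.injective (Subtype.ext hab)

/-- Evaluation at the `i`-th block of powers of `γ`. -/
noncomputable def blockEval (γ : F) (s i : ℕ) : F[X] →ₗ[F] (Fin s → F) :=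
  LinearMap.pi fun j => leval (γ ^ (s * i + (j : ℕ)))

theorem blockEval_apply (γ : F) (s i : ℕ) (f : F[X]) (j : Fin s) :
    blockEval γ s i f j = f.eval (γ ^ (s * i + (j : ℕ))) := rfl

theorem block_index_injective {s N : ℕ} {p p' : Fin N × Fin s}
    (h : s * (p.1 : ℕ) + (p.2 : ℕ) = s * (p'.1 : ℕ) + (p'.2 : ℕ)) : p = p' := by
  have hs : 0 < s := p.2.pos
  have h1 := congrArg (· / s) h
  have h2 := congrArg (· % s) h
  simp only [Nat.mul_add_div hs, Nat.div_eq_of_lt p.2.2, Nat.div_eq_of_lt p'.2.2,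
    Nat.mul_add_mod, Nat.mod_eq_of_lt p.2.2, Nat.mod_eq_of_lt p'.2.2] at h1 h2
  exact Prod.ext (Fin.ext (by simpa using h1)) (Fin.ext h2)

theorem block_index_lt {s N i j : ℕ} (hi : i < N) (hj : j < s) : s * i + j < s * N := by
  calc s * i + j < s * i + s := by omega
    _ = s * (i + 1) := by ring
    _ ≤ s * N := Nat.mul_le_mul_left s hi

/-- Folded Reed–Solomon codes are subspace designs. -/
theorem sum_finrank_inf_ker_blockEval_le {γ : F} {m s N r k : ℕ} (hγ : IsPrimitiveRoot γ m)
    (hγ0 : γ ≠ 0) (hsN : s * N ≤ m) (hk : k ≤ m) (H : Submodule F F[X]) [FiniteDimensional F H]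
    (hH : H ≤ degreeLT F k) (hr : Module.finrank F H = r) :
    (∑ i : Fin N, Module.finrank F (H ⊓ LinearMap.ker (blockEval γ s i) : Submodule F F[X])) *
      (s - r) ≤ r * k := by
  obtain ⟨f, hfH, hf0, hinj⟩ := exists_injective_natDegree H hr
  have hdeg : ∀ a, (f a).natDegree < k := fun a => by
    have := mem_degreeLT.1 (hH (hfH a))
    exact (natDegree_lt_iff_degree_lt (hf0 a)).2 this
  have hW : foldedWronskian γ f ≠ 0 :=
    foldedWronskian_ne_zero hγ hγ0 hf0 (fun a => (hdeg a).trans_le hk) hinj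
  have hWd := natDegree_foldedWronskian_le γ (f := f) fun a => (hdeg a).le
  refine le_trans ?_ hWd
  let d : Fin N → ℕ := fun i =>
    Module.finrank F (H ⊓ LinearMap.ker (blockEval γ s i) : Submodule F F[X])
  -- Only the first s − r points of a block are used, so that multiplying by γ^b with b < r stays in
  -- the block.
  let pt : Fin N × Fin (s - r) → F := fun p => γ ^ (s * (p.1 : ℕ) + (p.2 : ℕ))
  have hpt : Function.Injective pt := by
    intro p p' h
    have hlt : ∀ p : Fin N × Fin (s - r), s * (p.1 : ℕ) + (p.2 : ℕ) < m := fun p =>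
      (block_index_lt p.1.2 (p.2.2.trans_le (Nat.sub_le s r))).trans_le hsN
    have h1 := hγ.pow_inj (hlt p) (hlt p') h
    have h2 := block_index_injective (s := s) (N := N)
      (p := (p.1, Fin.castLE (Nat.sub_le s r) p.2))
      (p' := (p'.1, Fin.castLE (Nat.sub_le s r) p'.2)) h1
    have h3 := Prod.ext_iff.1 h2
    exact Prod.ext h3.1 (Fin.castLE_injective (Nat.sub_le s r) h3.2)
  have hdvd : (∏ p : Fin N × Fin (s - r), (X - C (pt p)) ^ d p.1) ∣ foldedWronskian γ f := by
    refine Finset.prod_dvd_of_coprime ?_ fun p _ => ?_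
    · intro p _ p' _ hne
      exact (pairwise_coprime_X_sub_C hpt hne).pow
    · refine X_sub_C_pow_dvd_foldedWronskian γ (pt p) H hr hfH _ fun g hg b hb => ?_
      have hlt : (p.2 : ℕ) + b < s := by have := p.2.2; omega
      have := congrFun (LinearMap.mem_ker.1 hg) ⟨(p.2 : ℕ) + b, hlt⟩
      rw [blockEval_apply] at this
      rw [← pow_add, show b + (s * (p.1 : ℕ) + (p.2 : ℕ)) = s * (p.1 : ℕ) + ((p.2 : ℕ) + b) by ring]
      exact this
  have h := natDegree_le_of_dvd hdvd hW
  rw [natDegree_prod _ _ fun p _ => pow_ne_zero _ (X_sub_C_ne_zero _)] at h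
  simp only [natDegree_pow, natDegree_X_sub_C, mul_one, Fintype.sum_prod_type, Finset.sum_const,
    Finset.card_univ, Fintype.card_fin, smul_eq_mul] at h
  rw [Finset.sum_mul]
  simpa only [mul_comm] using h

/-- A polynomial of degree less than `s * K` vanishing on `K` blocks is zero. -/
theorem eq_zero_of_blockEval_eq_zero {γ : F} {m s N K : ℕ} (hγ : IsPrimitiveRoot γ m)
    (hsN : s * N ≤ m) {f : F[X]} (hf : f.degree < (s * K : ℕ)) (T : Finset (Fin N))
    (hT : K ≤ T.card) (h : ∀ i ∈ T, blockEval γ s i f = 0) : f = 0 := by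
  refine eq_zero_of_degree_lt_of_eval_index_eq_zero (ι := Fin N × Fin s)
    (v := fun p => γ ^ (s * (p.1 : ℕ) + (p.2 : ℕ))) (s := T ×ˢ Finset.univ) ?_ ?_ ?_
  · intro p _ p' _ hpp
    exact block_index_injective (hγ.pow_inj
      ((block_index_lt p.1.2 p.2.2).trans_le hsN) ((block_index_lt p'.1.2 p'.2.2).trans_le hsN) hpp)
  · refine hf.trans_le ?_
    rw [Finset.card_product, Finset.card_univ, Fintype.card_fin, mul_comm]
    exact_mod_cast Nat.mul_le_mul_right s hT
  · intro p hp
    exact congrFun (h p.1 (Finset.mem_product.1 hp).1) p.2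

end FoldedWronskian

/-! ### From dimension over the extension field to rank over the subfield -/

section LowRank

theorem finrank_map_add_finrank_inf_ker {K E E' : Type*} [Field K] [AddCommGroup E] [Module K E]
    [AddCommGroup E'] [Module K E'] (f : E →ₗ[K] E') (W : Submodule K E) [FiniteDimensional K W] :
    Module.finrank K (W.map f) + Module.finrank K (W ⊓ LinearMap.ker f : Submodule K E) =
      Module.finrank K W := by
  rw [← LinearMap.finrank_range_add_finrank_ker (f.domRestrict W), LinearMap.range_domRestrict,
    LinearMap.ker_domRestrict, ← Submodule.finrank_map_subtype_eq W, Submodule.map_comap_subtype]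

theorem finrank_span_le_finrank {k F E : Type*} [Field k] [Field F] [Algebra k F] [AddCommGroup E]
    [Module k E] [Module F E] [IsScalarTower k F E] (X : Submodule k E) [FiniteDimensional k X] :
    Module.finrank F (Submodule.span F (X : Set E)) ≤ Module.finrank k X := by
  let b := Module.finBasis k X
  have h : Submodule.span F (X : Set E) = Submodule.span F (Set.range fun a => (b a : E)) := by
    refine le_antisymm (Submodule.span_le.2 fun x hx => ?_) (Submodule.span_mono ?_)
    · have := congrArg Subtype.val (b.sum_repr ⟨x, hx⟩)
      rw [Submodule.coe_sum] at this
      change _ = x at this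
      rw [← this]
      refine Submodule.sum_mem _ fun a _ => ?_
      rw [Submodule.coe_smul, ← algebraMap_smul F]
      exact Submodule.smul_mem _ _ (Submodule.subset_span ⟨a, rfl⟩)
    · rintro _ ⟨a, rfl⟩
      exact (b a).2
  rw [h]
  exact (finrank_range_le_card (R := F) fun a => (b a : E)).trans_eq (Fintype.card_fin _)

variable {k F : Type*} [Field k] [Field F] [Algebra k F]

/-- Descent: a nonzero element of `W` survives at some position of `B`. Restricting to the kernel
there lowers the F-dimension of `H` by at least one and the k-dimension of `W` by at most `M`. -/
theorem finrank_le_of_map_blockEval_finrank_le {γ : F} {m s N K M : ℕ}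
    (hγ : IsPrimitiveRoot γ m) (hsN : s * N ≤ m) (B : Finset (Fin N)) (hB : K ≤ B.card) (t : ℕ) :
    ∀ (H : Submodule F F[X]) [FiniteDimensional F H] (W : Submodule k F[X])
      [FiniteDimensional k W], (∀ f ∈ H, f.degree < (s * K : ℕ)) → (∀ f ∈ W, f ∈ H) →
      Module.finrank F H ≤ t →
      (∀ i ∈ B, Module.finrank k (W.map ((blockEval γ s i).restrictScalars k)) ≤ M) →
      Module.finrank k W ≤ t * M := by
  induction t with
  | zero =>
    intro H _ W _ _ hWH hH _
    have hH0 : H = ⊥ := Submodule.finrank_eq_zero.1 (Nat.le_zero.1 hH)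
    have hW0 : W = ⊥ := (Submodule.eq_bot_iff _).2 fun f hf => by
      have := hWH f hf
      rwa [hH0, Submodule.mem_bot] at this
    rw [hW0, finrank_bot]
    exact Nat.zero_le _
  | succ t ih =>
    intro H _ W _ hdeg hWH hH hrank
    by_cases hW0 : W = ⊥
    · rw [hW0, finrank_bot]
      exact Nat.zero_le _
    obtain ⟨f, hfW, hf0⟩ := Submodule.exists_mem_ne_zero_of_ne_bot hW0
    obtain ⟨i, hi, hif⟩ : ∃ i ∈ B, blockEval γ s i f ≠ 0 := by
      by_contra! hcon
      exact hf0 (eq_zero_of_blockEval_eq_zero hγ hsN (hdeg f (hWH f hfW)) B hB hcon)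
    let H' : Submodule F F[X] := H ⊓ LinearMap.ker (blockEval γ s i)
    let W' : Submodule k F[X] := W ⊓ LinearMap.ker ((blockEval γ s i).restrictScalars k)
    have : FiniteDimensional F H' := Submodule.finiteDimensional_of_le inf_le_left
    have : FiniteDimensional k W' := Submodule.finiteDimensional_of_le inf_le_left
    have hlt : Module.finrank F H' < Module.finrank F H := by
      refine Submodule.finrank_lt_finrank_of_lt (lt_of_le_of_ne inf_le_left fun h => hif ?_)
      have : f ∈ H' := h ▸ hWH f hfW
      exact this.2
    have h1 := ih H' W' (fun g hg => hdeg g hg.1) (fun g hg => ⟨hWH g hg.1, hg.2⟩) (by omega)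
      fun j hj => by
        have : FiniteDimensional k (W.map ((blockEval γ s j).restrictScalars k)) := inferInstance
        exact (Submodule.finrank_mono (Submodule.map_mono inf_le_left)).trans (hrank j hj)
    have h2 := finrank_map_add_finrank_inf_ker ((blockEval γ s i).restrictScalars k) W
    have h3 := hrank i hi
    have h4 : (t + 1) * M = t * M + M := by ring
    change _ + Module.finrank k W' = _ at h2
    omega

/-- A large `k`-space of codewords of the folded Reed–Solomon code over an extension `F` of `k` has
small `k`-rank at few positions. -/
theorem card_lowRank_blockEval {γ : F} {m s N K r M : ℕ} (hγ : IsPrimitiveRoot γ m)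
    (hγ0 : γ ≠ 0) (hsN : s * N ≤ m) (hKN : K ≤ N) (hM : 0 < M) (W : Submodule k F[X])
    [FiniteDimensional k W] (hW : ∀ f ∈ W, f.degree < (s * K : ℕ))
    (hrank : r * M ≤ Module.finrank k W) (B : Finset (Fin N))
    (hB : ∀ i ∈ B, Module.finrank k (W.map ((blockEval γ s i).restrictScalars k)) ≤ M) :
    B.card ≤ K ∨ B.card * (r - M) * (s - r) ≤ r * (s * K) := by
  have hspan : Submodule.span F (W : Set F[X]) ≤ degreeLT F (s * K) :=
    Submodule.span_le.2 fun f hf => mem_degreeLT.2 (hW f hf)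
  have : FiniteDimensional F (degreeLT F (s * K)) :=
    Module.Finite.equiv (degreeLTEquiv F (s * K)).symm
  have : FiniteDimensional F (Submodule.span F (W : Set F[X])) :=
    Submodule.finiteDimensional_of_le hspan
  -- If the F-span is large, r independent elements of `W` feed the subspace design bound. If it is
  -- small, the descent bounds dim W below r * M unless `B` has at most `K` elements.
  by_cases hcase : r ≤ Module.finrank F (Submodule.span F (W : Set F[X]))
  · right
    obtain ⟨g, hgW, -, hg⟩ := Submodule.exists_fun_fin_finrank_span_eq F (W : Set F[X])
    have hg' : LinearIndependent F (g ∘ Fin.castLE hcase) :=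
      hg.comp _ (Fin.castLE_injective hcase)
    let H := Submodule.span F (Set.range (g ∘ Fin.castLE hcase))
    have hHr : Module.finrank F H = r := by
      simpa using finrank_span_eq_card hg'
    have hHW : H ≤ Submodule.span F (W : Set F[X]) := by
      refine Submodule.span_mono ?_
      rintro _ ⟨a, rfl⟩
      exact hgW _
    have : FiniteDimensional F H := Submodule.finiteDimensional_of_le hHW
    have hmain := sum_finrank_inf_ker_blockEval_le hγ hγ0 hsN
      ((Nat.mul_le_mul_left s hKN).trans hsN) H (hHW.trans hspan) hHr
    refine le_trans (Nat.mul_le_mul_right _ ?_) hmain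
    rw [← smul_eq_mul, ← Finset.sum_const]
    -- At a position of `B` the image of `H` lies in the F-span of a k-space of dimension at most
    -- `M`, so the kernel has dimension at least r − M.
    refine (Finset.sum_le_sum fun i hi => ?_).trans
      (Finset.sum_le_sum_of_subset (Finset.subset_univ B))
    have h1 := finrank_map_add_finrank_inf_ker (blockEval γ s i) H
    have h2 : Module.finrank F (H.map (blockEval γ s i)) ≤ M := by
      refine le_trans ?_ (hB i hi)
      refine le_trans ?_ (finrank_span_le_finrank (F := F)
        (W.map ((blockEval γ s i).restrictScalars k)))
      have hle : H.map (blockEval γ s i) ≤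
          Submodule.span F (W.map ((blockEval γ s i).restrictScalars k) : Set (Fin s → F)) := by
        refine (Submodule.map_mono hHW).trans ?_
        rw [Submodule.map_span]
        exact Submodule.span_mono (by rintro _ ⟨x, hx, rfl⟩; exact ⟨x, hx, rfl⟩)
      exact Submodule.finrank_mono hle
    omega
  · left
    by_contra! hlt
    have := finrank_le_of_map_blockEval_finrank_le (k := k) hγ hsN B hlt.le _
      (Submodule.span F (W : Set F[X])) W (fun f hf => mem_degreeLT.1 (hspan hf))
      (fun f hf => Submodule.subset_span hf) le_rfl hB
    have h2 := Nat.mul_lt_mul_of_pos_right (not_le.1 hcase) hM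
    omega

end LowRank

/-! ### Union bound over greedily chosen words -/

section Counting

open Classical in
/-- The positions at which the word `u` avoids the family of subspaces `P`. -/
noncomputable def freshPositions {k : Type*} [Field k] {N n : ℕ}
    (P : Fin N → Submodule k (Fin n → k)) (u : Fin N → Fin n → k) : Finset (Fin N) :=
  Finset.univ.filter fun i => u i ∉ P i

/-- The number of positions of `S` that lie in blocks from `A`. -/
def blockWeight {N n : ℕ} (S : Finset (Fin N × Fin n)) (A : Finset (Fin N)) : ℕ :=
  (S.filter fun p => p.1 ∈ A).card

variable {k : Type*} [Field k] {N n : ℕ}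

/-- The vectors orthogonal to a subspace for the dot product. -/
def dotAnnihilator (P : Submodule k (Fin n → k)) : Submodule k (Fin n → k) where
  carrier := {g | ∀ x ∈ P, x ⬝ᵥ g = 0}
  add_mem' ha hb x hx := by rw [dotProduct_add, ha x hx, hb x hx, add_zero]
  zero_mem' x _ := dotProduct_zero x
  smul_mem' c g hg x hx := by rw [dotProduct_smul, hg x hx, smul_zero]

theorem dotAnnihilator_anti {P P' : Submodule k (Fin n → k)} (h : P ≤ P') :
    dotAnnihilator P' ≤ dotAnnihilator P := fun _ hg x hx => hg x (h hx)

theorem mem_dotAnnihilator_sup_span {P : Submodule k (Fin n → k)} {x g : Fin n → k}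
    (hg : g ∈ dotAnnihilator P) (hx : x ⬝ᵥ g = 0) :
    g ∈ dotAnnihilator (P ⊔ Submodule.span k {x}) := by
  intro y hy
  obtain ⟨a, ha, b, hb, rfl⟩ := Submodule.mem_sup.1 hy
  obtain ⟨c, rfl⟩ := Submodule.mem_span_singleton.1 hb
  rw [add_dotProduct, hg a ha, smul_dotProduct, hx, smul_zero, add_zero]

theorem exists_mem_dotAnnihilator_dotProduct_ne_zero {P : Submodule k (Fin n → k)} {x : Fin n → k}
    (hx : x ∉ P) : ∃ g ∈ dotAnnihilator P, x ⬝ᵥ g ≠ 0 := by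
  obtain ⟨f, hfx, hf⟩ := Submodule.exists_le_ker_of_notMem hx
  have hrep : ∀ y : Fin n → k, y ⬝ᵥ (fun i => f (Pi.single i 1)) = f y := fun y => by
    conv_rhs => rw [pi_eq_sum_univ' y]
    simp [dotProduct, map_sum]
  exact ⟨fun i => f (Pi.single i 1), fun y hy => (hrep y).trans (hf hy), by rwa [hrep]⟩

variable [Fintype k]

open Classical in
-- The translates of the smaller annihilator by multiples of a vector not orthogonal to `x` are
-- disjoint.
theorem card_dotAnnihilator_sup_span_mul_le {P : Submodule k (Fin n → k)} {x : Fin n → k}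
    (hx : x ∉ P) :
    Fintype.card (dotAnnihilator (P ⊔ Submodule.span k {x})) * Fintype.card k ≤
      Fintype.card (dotAnnihilator P) := by
  obtain ⟨g₀, hg₀, hne⟩ := exists_mem_dotAnnihilator_dotProduct_ne_zero hx
  rw [← Fintype.card_prod]
  have hmem : x ∈ P ⊔ Submodule.span k {x} :=
    Submodule.mem_sup_right (Submodule.mem_span_singleton_self x)
  refine Fintype.card_le_of_injective
    (fun p => ⟨p.1 + p.2 • g₀, Submodule.add_mem _ (dotAnnihilator_anti le_sup_left p.1.2)
      (Submodule.smul_mem _ _ hg₀)⟩) fun p p' h => ?_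
  have h1 : (p.1 : Fin n → k) + p.2 • g₀ = p'.1 + p'.2 • g₀ := congrArg Subtype.val h
  have h2 := congrArg (x ⬝ᵥ ·) h1
  simp only [dotProduct_add, dotProduct_smul, p.1.2 x hmem, p'.1.2 x hmem, zero_add,
    smul_eq_mul] at h2
  have h3 := mul_right_cancel₀ hne h2
  rw [h3] at h1
  exact Prod.ext (Subtype.ext (add_right_cancel h1)) h3

/-- The matrix tuples whose columns at the positions of `S` are orthogonal to the family `P`. -/
def annihilatingTuples (S : Finset (Fin N × Fin n)) (P : Fin N → Submodule k (Fin n → k)) :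
    Set (Fin N → Matrix (Fin n) (Fin n) k) :=
  {G | ∀ p ∈ S, (fun a => G p.1 a p.2) ∈ dotAnnihilator (P p.1)}

open Classical in
-- The conditions concern separate columns, so the count factors over positions.
theorem card_annihilatingTuples (S : Finset (Fin N × Fin n))
    (P : Fin N → Submodule k (Fin n → k)) :
    (annihilatingTuples S P).ncard = ∏ p : Fin N × Fin n,
      if p ∈ S then Fintype.card (dotAnnihilator (P p.1)) else Fintype.card (Fin n → k) := by
  let e : (Fin N → Matrix (Fin n) (Fin n) k) ≃ (Fin N × Fin n → Fin n → k) :=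
    { toFun := fun G p a => G p.1 a p.2
      invFun := fun g i a j => g (i, j) a
      left_inv := fun _ => rfl
      right_inv := fun _ => rfl }
  let t : Fin N × Fin n → Finset (Fin n → k) := fun p =>
    if p ∈ S then Finset.univ.filter (· ∈ dotAnnihilator (P p.1)) else Finset.univ
  have h1 : e '' annihilatingTuples S P = (Fintype.piFinset t : Set (Fin N × Fin n → Fin n → k)) := by
    ext g
    rw [Finset.mem_coe, Fintype.mem_piFinset]
    constructor
    · rintro ⟨G, hG, rfl⟩ p
      by_cases hp : p ∈ S
      · simp only [t, hp, if_true, Finset.mem_filter, Finset.mem_univ, true_and]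
        exact hG p hp
      · simp [t, hp]
    · intro hg
      refine ⟨e.symm g, fun p hp => ?_, e.apply_symm_apply g⟩
      have := hg p
      simp only [t, hp, if_true, Finset.mem_filter, Finset.mem_univ, true_and] at this
      exact this
  rw [← Set.ncard_image_of_injective _ e.injective, h1, Set.ncard_coe_finset, Fintype.card_piFinset]
  refine Finset.prod_congr rfl fun p _ => ?_
  by_cases hp : p ∈ S
  · simp only [t, hp, if_true]
    exact (Fintype.card_subtype _).symm
  · simp only [t, hp, if_false, Finset.card_univ]

/-- Conditional probability in counting form: given that the family is annihilated, annihilating `u`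
as well costs a factor q at each position of `S` in a fresh block. -/
theorem card_annihilatingTuples_sup_span_mul_le (S : Finset (Fin N × Fin n))
    (P : Fin N → Submodule k (Fin n → k)) (u : Fin N → Fin n → k) :
    (annihilatingTuples S fun i => P i ⊔ Submodule.span k {u i}).ncard *
        Fintype.card k ^ blockWeight S (freshPositions P u) ≤
      (annihilatingTuples S P).ncard := by
  classical
  rw [card_annihilatingTuples, card_annihilatingTuples, blockWeight, ← Finset.prod_const,
    Finset.prod_filter, ← Finset.prod_filter_mul_prod_filter_not Finset.univ (· ∈ S),
    ← Finset.prod_filter_mul_prod_filter_not Finset.univ (· ∈ S)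
      (f := fun p => if p ∈ S then Fintype.card (dotAnnihilator (P p.1)) else _),
    mul_right_comm]
  refine Nat.mul_le_mul ?_ (le_of_eq (Finset.prod_congr rfl fun p hp => ?_))
  · rw [Finset.filter_mem_eq_inter, Finset.univ_inter, ← Finset.prod_mul_distrib]
    refine Finset.prod_le_prod' fun p hp => ?_
    rw [if_pos hp, if_pos hp]
    by_cases hu : u p.1 ∈ P p.1
    · rw [if_neg (by simpa [freshPositions] using hu), mul_one]
      exact Fintype.card_subtype_mono _ _ (dotAnnihilator_anti le_sup_left)
    · rw [if_pos (by simpa [freshPositions] using hu)]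
      exact card_dotAnnihilator_sup_span_mul_le hu
  · rw [if_neg (Finset.mem_filter.1 hp).2, if_neg (Finset.mem_filter.1 hp).2]

/-- A linear code in which a codeword with `K` zero positions vanishes. -/
def HasZeroBound (V : Submodule k (Fin N → Fin n → k)) (K : ℕ) : Prop :=
  ∀ u ∈ V, ∀ T : Finset (Fin N), K ≤ T.card → (∀ i ∈ T, u i = 0) → u = 0

open Classical in
theorem card_freshPositions_eq_le {V : Submodule k (Fin N → Fin n → k)} {K J : ℕ}
    (hV : HasZeroBound V K) (hKN : K ≤ N) (P : Fin N → Submodule k (Fin n → k))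
    (hP : ∀ i, Module.finrank k (P i) ≤ J) (A : Finset (Fin N)) :
    (Finset.univ.filter fun u => u ∈ V ∧ freshPositions P u = A).card ≤
      Fintype.card k ^ (J * N + n * (K - Aᶜ.card)) := by
  -- A word is determined by any `K` positions. Taking as many as possible outside `A`, where only
  -- the at most q^J values in `P i` are allowed, minimizes the free ones.
  obtain ⟨T, hT, hTA⟩ : ∃ T : Finset (Fin N), T.card = K ∧ (T ∩ A).card = K - Aᶜ.card := by
    rcases le_total K Aᶜ.card with h | h
    · obtain ⟨T, hTA, hT⟩ := Finset.exists_subset_card_eq h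
      refine ⟨T, hT, ?_⟩
      rw [Nat.sub_eq_zero_of_le h, Finset.card_eq_zero, ← Finset.disjoint_iff_inter_eq_empty]
      exact Finset.disjoint_left.2 fun i hi => Finset.mem_compl.1 (hTA hi)
    · obtain ⟨T, hAT, -, hT⟩ := Finset.exists_subsuperset_card_eq (Finset.subset_univ Aᶜ) h
        (by simpa using hKN)
      refine ⟨T, hT, ?_⟩
      have h1 : T ∩ A = T \ Aᶜ := by ext i; simp
      rw [h1, Finset.card_sdiff_of_subset hAT, hT]
  let t : Fin N → Finset (Fin n → k) := fun i =>
    if i ∈ T then if i ∈ A then Finset.univ else Finset.univ.filter (· ∈ P i) else {0}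
  have hinj : (Finset.univ.filter fun u => u ∈ V ∧ freshPositions P u = A).card ≤
      (Fintype.piFinset t).card := by
    refine Finset.card_le_card_of_injOn (fun u i => if i ∈ T then u i else 0) ?_ ?_
    · intro u hu
      obtain ⟨-, hu⟩ := (Finset.mem_filter (s := Finset.univ)).1 hu
      rw [Finset.mem_coe, Fintype.mem_piFinset]
      intro i
      by_cases hiT : i ∈ T
      · by_cases hiA : i ∈ A
        · simp [t, hiT, hiA]
        · have : u i ∈ P i := by
            rw [← hu.2] at hiA
            simpa [freshPositions] using hiA
          simp [t, hiT, hiA, this]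
      · simp [t, hiT]
    · intro u hu u' hu' h
      have h1 := ((Finset.mem_filter (s := Finset.univ)).1 hu).2.1
      have h2 := ((Finset.mem_filter (s := Finset.univ)).1 hu').2.1
      refine sub_eq_zero.1 (hV _ (V.sub_mem h1 h2) T hT.ge fun i hi => ?_)
      have := congrFun h i
      simp only [hi, if_true] at this
      rw [Pi.sub_apply, this, sub_self]
  refine hinj.trans ?_
  have hq : 0 < Fintype.card k := Fintype.card_pos
  rw [Fintype.card_piFinset]
  calc ∏ i, (t i).card ≤ ∏ i : Fin N, Fintype.card k ^ J *
        (if i ∈ T ∩ A then Fintype.card k ^ n else 1) := by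
        refine Finset.prod_le_prod' fun i _ => ?_
        by_cases hiT : i ∈ T
        · by_cases hiA : i ∈ A
          · simpa [t, hiT, hiA] using Nat.le_mul_of_pos_left _ (Nat.pow_pos hq)
          · simp only [t, hiT, hiA, if_true, if_false, Finset.mem_inter, and_false, mul_one]
            rw [← Fintype.card_subtype]
            change Fintype.card (P i) ≤ _
            rw [Module.card_eq_pow_finrank (K := k)]
            exact Nat.pow_le_pow_right hq (hP i)
        · simpa [t, hiT] using Nat.one_le_pow J _ hq
    _ = _ := by
        rw [Finset.prod_mul_distrib, Finset.prod_const, Finset.card_univ, Fintype.card_fin,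
          Finset.prod_ite_mem, Finset.univ_inter, Finset.prod_const, hTA, ← pow_mul, ← pow_mul,
          ← pow_add]

open Classical in
-- The words are grouped by their fresh set; the term `N` in the exponent pays for the 2^N ≤ q^N
-- possible sets.
theorem sum_inv_pow_blockWeight_le {V : Submodule k (Fin N → Fin n → k)} {K J : ℕ}
    (hV : HasZeroBound V K) (hKN : K ≤ N) (S : Finset (Fin N × Fin n)) {τ x : ℝ}
    (hS : ∀ A : Finset (Fin N), (Aᶜ.card : ℝ) ≤ τ →
      ((n * (K - Aᶜ.card) : ℕ) : ℝ) - blockWeight S A ≤ -x)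
    (P : Fin N → Submodule k (Fin n → k)) (hP : ∀ i, Module.finrank k (P i) ≤ J) :
    ∑ u : Fin N → Fin n → k with u ∈ V ∧ ((freshPositions P u)ᶜ.card : ℝ) ≤ τ,
      ((Fintype.card k : ℝ) ^ blockWeight S (freshPositions P u))⁻¹ ≤
      (Fintype.card k : ℝ) ^ ((N : ℝ) + J * N - x) := by
  have hq2 : (2 : ℝ) ≤ Fintype.card k := by exact_mod_cast Fintype.one_lt_card
  have hq0 : (0 : ℝ) < Fintype.card k := by linarith
  rw [← Finset.sum_fiberwise (s := Finset.univ.filter _) (g := freshPositions P)]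
  calc _ ≤ ∑ _A : Finset (Fin N), (Fintype.card k : ℝ) ^ ((J : ℝ) * N - x) := by
        refine Finset.sum_le_sum fun A _ => ?_
        by_cases hA : (Aᶜ.card : ℝ) ≤ τ
        · calc _ ≤ ∑ u : Fin N → Fin n → k with u ∈ V ∧ freshPositions P u = A,
                ((Fintype.card k : ℝ) ^ blockWeight S A)⁻¹ := by
                rw [Finset.filter_filter]
                have : ∀ u ∈ Finset.univ.filter fun u => (u ∈ V ∧
                    ((freshPositions P u)ᶜ.card : ℝ) ≤ τ) ∧ freshPositions P u = A,
                    ((Fintype.card k : ℝ) ^ blockWeight S (freshPositions P u))⁻¹ =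
                    ((Fintype.card k : ℝ) ^ blockWeight S A)⁻¹ := fun u hu => by
                  rw [(Finset.mem_filter.1 hu).2.2]
                rw [Finset.sum_congr rfl this]
                refine Finset.sum_le_sum_of_subset_of_nonneg ?_ fun _ _ _ => by positivity
                intro u hu
                have := (Finset.mem_filter.1 hu).2
                exact Finset.mem_filter.2 ⟨Finset.mem_univ _, this.1.1, this.2⟩
            _ ≤ (Fintype.card k : ℝ) ^ (J * N + n * (K - Aᶜ.card)) *
                ((Fintype.card k : ℝ) ^ blockWeight S A)⁻¹ := by
                rw [Finset.sum_const, nsmul_eq_mul]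
                refine mul_le_mul_of_nonneg_right ?_ (by positivity)
                exact_mod_cast card_freshPositions_eq_le hV hKN P hP A
            _ ≤ _ := by
                rw [← Real.rpow_natCast, ← Real.rpow_natCast, ← Real.rpow_neg hq0.le,
                  ← Real.rpow_add hq0]
                refine Real.rpow_le_rpow_of_exponent_le (by linarith) ?_
                have := hS A hA
                push_cast at this ⊢
                linarith
        · rw [Finset.sum_eq_zero]
          · positivity
          · intro u hu
            rw [Finset.filter_filter] at hu
            obtain ⟨⟨-, h1⟩, h2⟩ := (Finset.mem_filter.1 hu).2
            rw [h2] at h1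
            exact absurd h1 hA
    _ = (2 : ℝ) ^ N * (Fintype.card k : ℝ) ^ ((J : ℝ) * N - x) := by
        simp
    _ ≤ (Fintype.card k : ℝ) ^ (N : ℝ) * (Fintype.card k : ℝ) ^ ((J : ℝ) * N - x) := by
        refine mul_le_mul_of_nonneg_right ?_ (by positivity)
        rw [Real.rpow_natCast]
        exact pow_le_pow_left₀ (by norm_num) hq2 N
    _ = _ := by
        rw [← Real.rpow_add hq0]
        congr 1
        ring

/-- Union bound over greedily chosen codewords, each of which is annihilated at all the positions
of `S` and avoids the span of its predecessors at many positions. -/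
theorem ncard_bad_inter_annihilatingTuples_le {V : Submodule k (Fin N → Fin n → k)} {K J : ℕ}
    (hV : HasZeroBound V K) (hKN : K ≤ N) (S : Finset (Fin N × Fin n)) {τ x : ℝ}
    (hS : ∀ A : Finset (Fin N), (Aᶜ.card : ℝ) ≤ τ →
      ((n * (K - Aᶜ.card) : ℕ) : ℝ) - blockWeight S A ≤ -x)
    (bad : Set (Fin N → Matrix (Fin n) (Fin n) k))
    (hbad : ∀ G ∈ bad, ∀ P : Fin N → Submodule k (Fin n → k),
      (∀ i, Module.finrank k (P i) ≤ J) → ∃ u ∈ V, ((freshPositions P u)ᶜ.card : ℝ) ≤ τ ∧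
        ∀ p ∈ S, (u p.1 ᵥ* G p.1) p.2 = 0) (j : ℕ) :
    ∀ P : Fin N → Submodule k (Fin n → k), (∀ i, Module.finrank k (P i) + j ≤ J + 1) →
      ((bad ∩ annihilatingTuples S P).ncard : ℝ) ≤
        ((Fintype.card k : ℝ) ^ ((N : ℝ) + J * N - x)) ^ j * (annihilatingTuples S P).ncard := by
  classical
  induction j with
  | zero =>
    intro P _
    rw [pow_zero, one_mul]
    exact_mod_cast Set.ncard_le_ncard Set.inter_subset_right (Set.toFinite _)
  | succ j ih =>
    intro P hP
    have hq0 : (0 : ℝ) < Fintype.card k := by exact_mod_cast Fintype.card_pos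
    -- Here j counts the words still to be chosen. Each raises every dimension by at most one, so
    -- the invariant keeps the dimensions at most `J` whenever a word is chosen.
    have hPJ : ∀ i, Module.finrank k (P i) ≤ J := fun i => by have := hP i; omega
    let Q : (Fin N → Fin n → k) → Fin N → Submodule k (Fin n → k) := fun u i =>
      P i ⊔ Submodule.span k {u i}
    have hQ : ∀ u i, Module.finrank k (Q u i) + j ≤ J + 1 := fun u i => by
      have h1 := Submodule.finrank_add_le_finrank_add_finrank (P i) (Submodule.span k {u i})
      have h2 := (finrank_span_le_card (R := k) {u i}).trans_eq (Set.toFinset_card _)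
      rw [Fintype.card_unique] at h2
      have := hP i
      change Module.finrank k (P i ⊔ Submodule.span k {u i} : Submodule k (Fin n → k)) + j ≤ _
      omega
    let U : Finset (Fin N → Fin n → k) :=
      Finset.univ.filter fun u => u ∈ V ∧ ((freshPositions P u)ᶜ.card : ℝ) ≤ τ
    have hcover : bad ∩ annihilatingTuples S P ⊆
        ⋃ u ∈ U, bad ∩ annihilatingTuples S (Q u) := by
      rintro G ⟨hG, hGP⟩
      obtain ⟨u, huV, hu, hz⟩ := hbad G hG P hPJ
      refine Set.mem_biUnion (Finset.mem_coe.2 (Finset.mem_filter.2 ⟨Finset.mem_univ u, huV, hu⟩))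
        ⟨hG, fun p hp => mem_dotAnnihilator_sup_span (hGP p hp) (hz p hp)⟩
    have hcard : (bad ∩ annihilatingTuples S P).ncard ≤
        ∑ u ∈ U, (bad ∩ annihilatingTuples S (Q u)).ncard :=
      (Set.ncard_le_ncard hcover (Set.toFinite _)).trans (Finset.set_ncard_biUnion_le _ _)
    set β := (Fintype.card k : ℝ) ^ ((N : ℝ) + J * N - x) with hβ
    have hβ0 : 0 < β := Real.rpow_pos_of_pos hq0 _
    calc ((bad ∩ annihilatingTuples S P).ncard : ℝ)
        ≤ ∑ u ∈ U, ((bad ∩ annihilatingTuples S (Q u)).ncard : ℝ) := by exact_mod_cast hcard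
      _ ≤ ∑ u ∈ U, β ^ j * (((Fintype.card k : ℝ) ^ blockWeight S (freshPositions P u))⁻¹ *
            (annihilatingTuples S P).ncard) := by
          refine Finset.sum_le_sum fun u _ => (ih (Q u) (hQ u)).trans ?_
          refine mul_le_mul_of_nonneg_left ?_ (by positivity)
          rw [le_inv_mul_iff₀ (by positivity), mul_comm]
          exact_mod_cast card_annihilatingTuples_sup_span_mul_le S P u
      _ = β ^ j * ((∑ u ∈ U, ((Fintype.card k : ℝ) ^ blockWeight S (freshPositions P u))⁻¹) *
            (annihilatingTuples S P).ncard) := by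
          rw [← Finset.mul_sum, ← Finset.sum_mul]
      _ ≤ β ^ j * (β * (annihilatingTuples S P).ncard) := by
          refine mul_le_mul_of_nonneg_left (mul_le_mul_of_nonneg_right ?_ (by positivity))
            (by positivity)
          exact sum_inv_pow_blockWeight_le hV hKN S hS P hPJ
      _ = _ := by rw [pow_succ]; ring

theorem ncard_bad_le {V : Submodule k (Fin N → Fin n → k)} {K J : ℕ}
    (hV : HasZeroBound V K) (hKN : K ≤ N) (S : Finset (Fin N × Fin n)) {τ x : ℝ}
    (hS : ∀ A : Finset (Fin N), (Aᶜ.card : ℝ) ≤ τ →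
      ((n * (K - Aᶜ.card) : ℕ) : ℝ) - blockWeight S A ≤ -x)
    (bad : Set (Fin N → Matrix (Fin n) (Fin n) k))
    (hbad : ∀ G ∈ bad, ∀ P : Fin N → Submodule k (Fin n → k),
      (∀ i, Module.finrank k (P i) ≤ J) → ∃ u ∈ V, ((freshPositions P u)ᶜ.card : ℝ) ≤ τ ∧
        ∀ p ∈ S, (u p.1 ᵥ* G p.1) p.2 = 0) :
    (bad.ncard : ℝ) ≤ (Fintype.card k : ℝ) ^ (((N : ℝ) + J * N - x) * (J + 1)) *
      Nat.card (Fin N → Matrix (Fin n) (Fin n) k) := by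
  have h := ncard_bad_inter_annihilatingTuples_le hV hKN S hS bad hbad (J + 1) (fun _ => ⊥)
    fun _ => by rw [finrank_bot, zero_add]
  have huniv : annihilatingTuples S (fun _ : Fin N => (⊥ : Submodule k (Fin n → k))) = Set.univ := by
    refine Set.eq_univ_of_forall fun G p _ x hx => ?_
    rw [(Submodule.mem_bot k).1 hx, zero_dotProduct]
  rw [huniv, Set.inter_univ, Set.ncard_univ, ← Real.rpow_natCast, ← Real.rpow_mul (by positivity)]
    at h
  exact_mod_cast h

/-- A space of words of large rank at most positions contains a word avoiding given
low-dimensional subspaces at most positions. -/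
theorem exists_card_compl_freshPositions_le (W : Submodule k (Fin N → Fin n → k))
    {J M : ℕ} (B : Finset (Fin N))
    (hB : ∀ i ∉ B, M ≤ Module.finrank k (W.map (LinearMap.proj (R := k) (φ := fun _ : Fin N => Fin n → k) i)))
    (P : Fin N → Submodule k (Fin n → k)) (hP : ∀ i, Module.finrank k (P i) ≤ J) :
    ∃ u ∈ W, ((freshPositions P u)ᶜ.card : ℝ) ≤
      B.card + N * ((Fintype.card k : ℝ) ^ J / (Fintype.card k : ℝ) ^ M) := by
  classical
  have hq0 : (0 : ℝ) < Fintype.card k := by exact_mod_cast Fintype.card_pos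
  have hq1 : (1 : ℝ) ≤ Fintype.card k := by exact_mod_cast Fintype.card_pos
  set ρ := (Fintype.card k : ℝ) ^ J / (Fintype.card k : ℝ) ^ M with hρ
  let Wf : Finset (Fin N → Fin n → k) := Finset.univ.filter (· ∈ W)
  have hWf : Wf.Nonempty := ⟨0, Finset.mem_filter.2 ⟨Finset.mem_univ _, W.zero_mem⟩⟩
  suffices h : ∑ u ∈ Wf, ((freshPositions P u)ᶜ.card : ℝ) ≤ ∑ _u ∈ Wf, (B.card + N * ρ) by
    obtain ⟨u, hu, hle⟩ := Finset.exists_le_of_sum_le hWf h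
    exact ⟨u, (Finset.mem_filter.1 hu).2, hle⟩
  have hcomm : ∑ u ∈ Wf, ((freshPositions P u)ᶜ.card : ℝ) =
      ∑ i : Fin N, ((Wf.filter fun u => u i ∈ P i).card : ℝ) := by
    simp only [Finset.card_eq_sum_ones, Nat.cast_sum, Finset.sum_filter]
    rw [Finset.sum_comm]
    refine Finset.sum_congr rfl fun u _ => ?_
    have : (freshPositions P u)ᶜ = Finset.univ.filter fun i => u i ∈ P i := by
      ext i
      simp [freshPositions]
    rw [this, Finset.sum_filter]
    simp only [Nat.cast_ite, Nat.cast_one, Nat.cast_zero]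
  have hcardW : (Wf.card : ℝ) = (Fintype.card k : ℝ) ^ Module.finrank k W := by
    rw [← Fintype.card_subtype]
    rw [Module.card_eq_pow_finrank (K := k), Nat.cast_pow]
  -- Projecting to coordinate i maps `W` to rank at least `M`, whereas the words with i-th entry in
  -- `P i` have image of rank at most `J`: a proportion of at most q^(J−M).
  have hterm : ∀ i ∉ B, ((Wf.filter fun u => u i ∈ P i).card : ℝ) ≤ Wf.card * ρ := by
    intro i hi
    let pr : (Fin N → Fin n → k) →ₗ[k] (Fin n → k) := LinearMap.proj i
    let W' := W ⊓ (P i).comap pr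
    have h1 := finrank_map_add_finrank_inf_ker pr W
    have h2 := finrank_map_add_finrank_inf_ker pr W'
    have h3 : Module.finrank k (W'.map pr) ≤ J :=
      (Submodule.finrank_mono ((Submodule.map_mono inf_le_right).trans
        (Submodule.map_comap_le _ _))).trans (hP i)
    have h4 : Module.finrank k (W' ⊓ LinearMap.ker pr : Submodule k _) ≤
        Module.finrank k (W ⊓ LinearMap.ker pr : Submodule k _) :=
      Submodule.finrank_mono (inf_le_inf_right _ inf_le_left)
    have h5 : M ≤ Module.finrank k (W.map pr) := hB i hi
    have h6 : Module.finrank k W' + M ≤ Module.finrank k W + J := by omega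
    have h7 : ((Wf.filter fun u => u i ∈ P i).card : ℝ) =
        (Fintype.card k : ℝ) ^ Module.finrank k W' := by
      have : (Wf.filter fun u => u i ∈ P i) = Finset.univ.filter (· ∈ W') := by
        ext u
        simp [Wf, W', pr]
      rw [this, ← Fintype.card_subtype]
      change (Fintype.card W' : ℝ) = _
      rw [Module.card_eq_pow_finrank (K := k), Nat.cast_pow]
    rw [h7, hcardW, hρ, ← mul_div_assoc, le_div_iff₀ (by positivity), ← pow_add, ← pow_add]
    exact pow_le_pow_right₀ hq1 h6
  rw [hcomm, Finset.sum_const, nsmul_eq_mul]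
  calc ∑ i : Fin N, ((Wf.filter fun u => u i ∈ P i).card : ℝ)
      ≤ ∑ i : Fin N, ((if i ∈ B then (Wf.card : ℝ) else 0) + Wf.card * ρ) := by
        refine Finset.sum_le_sum fun i _ => ?_
        by_cases hi : i ∈ B
        · rw [if_pos hi]
          have : ((Wf.filter fun u => u i ∈ P i).card : ℝ) ≤ Wf.card := by
            exact_mod_cast Finset.card_filter_le _ _
          have : 0 ≤ Wf.card * ρ := by positivity
          linarith
        · rw [if_neg hi, zero_add]
          exact hterm i hi
    _ = _ := by
        rw [Finset.sum_add_distrib, Finset.sum_ite_mem, Finset.univ_inter, Finset.sum_const,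
          Finset.sum_const, Finset.card_univ, Fintype.card_fin, nsmul_eq_mul, nsmul_eq_mul]
        ring

end Counting

/-! ### The concatenated code as a linear code -/

section Concatenation

/-- The words `(u i G i)ᵢ` obtained by encoding the blocks of `u` with the matrices `G i`. -/
def blockEncode {k : Type*} [Field k] {N n : ℕ} (G : Fin N → Matrix (Fin n) (Fin n) k) :
    (Fin N → Fin n → k) →ₗ[k] (Fin N × Fin n → k) where
  toFun u p := (u p.1 ᵥ* G p.1) p.2
  map_add' u v := by
    ext p
    simp [Matrix.add_vecMul]
  map_smul' c u := by
    ext p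
    simp [Matrix.smul_vecMul]

/-- The words of `V` whose encoding vanishes on `S`. -/
def vanishingSubspace {k : Type*} [Field k] {N n : ℕ} (V : Submodule k (Fin N → Fin n → k))
    (G : Fin N → Matrix (Fin n) (Fin n) k) (S : Finset (Fin N × Fin n)) :
    Submodule k (Fin N → Fin n → k) :=
  V ⊓ ⨅ p ∈ S, LinearMap.ker (LinearMap.proj p ∘ₗ blockEncode G)

theorem mem_vanishingSubspace {k : Type*} [Field k] {N n : ℕ}
    {V : Submodule k (Fin N → Fin n → k)} {G : Fin N → Matrix (Fin n) (Fin n) k}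
    {S : Finset (Fin N × Fin n)} {u : Fin N → Fin n → k} :
    u ∈ vanishingSubspace V G S ↔ u ∈ V ∧ ∀ p ∈ S, (u p.1 ᵥ* G p.1) p.2 = 0 := by
  simp only [vanishingSubspace, Submodule.mem_inf, Submodule.mem_iInf, LinearMap.mem_ker]
  rfl

theorem one_sub_le_uniformProb {Ω : Type*} [Finite Ω] [Nonempty Ω] {E : Ω → Prop} {x : ℝ}
    (h : ({ω | ¬ E ω}.ncard : ℝ) ≤ x * Nat.card Ω) : 1 - x ≤ uniformProb E := by
  have hpos : (0 : ℝ) < Nat.card Ω := by exact_mod_cast Nat.card_pos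
  rw [uniformProb, le_div_iff₀ hpos]
  have h1 : ({ω | E ω}.ncard : ℝ) + ({ω | ¬ E ω}.ncard : ℝ) = Nat.card Ω := by
    exact_mod_cast Set.ncard_add_ncard_compl {ω | E ω} (Set.toFinite _) (Set.toFinite _)
  linarith

/-- A linear code is list decodable from erasures if few of its words vanish on any large set of
positions. -/
theorem erasureListDecodable_of_finrank_le {k : Type*} [Field k] [Fintype k] {N n D L : ℕ}
    (V : Submodule k (Fin N → Fin n → k)) (G : Fin N → Matrix (Fin n) (Fin n) k) {ρ : ℝ}
    (hL : Fintype.card k ^ D ≤ L)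
    (h : ∀ S : Finset (Fin N × Fin n), (1 - ρ) * (n * N) ≤ S.card →
      Module.finrank k (vanishingSubspace V G S) ≤ D) :
    ErasureListDecodable ρ L (V.map (blockEncode G) : Set (Fin N × Fin n → k)) := by
  classical
  intro y hy
  let S : Finset (Fin N × Fin n) := Finset.univ.filter fun p => y p ≠ none
  have hSc : (S.card : ℝ) + erasureWeight y = n * N := by
    have h1 : erasureWeight y = (Finset.univ.filter fun p => y p = none).card := by
      rw [erasureWeight, ← Set.ncard_coe_finset]
      simp
    have h2 := Finset.card_filter_add_card_filter_not (s := (Finset.univ : Finset (Fin N × Fin n)))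
      (fun p => y p = none)
    rw [Finset.card_univ, Fintype.card_prod, Fintype.card_fin, Fintype.card_fin] at h2
    rw [h1, mul_comm (n : ℝ), add_comm]
    exact_mod_cast h2
  rw [Fintype.card_prod, Fintype.card_fin, Fintype.card_fin] at hy
  push_cast at hy
  have hfin := h S (by nlinarith)
  rcases Set.eq_empty_or_nonempty
    {c | c ∈ (V.map (blockEncode G) : Set (Fin N × Fin n → k)) ∧ AgreesWith c y} with h0 | h0
  · rw [h0, Set.encard_empty]
    exact zero_le
  obtain ⟨_, ⟨u₀, hu₀, rfl⟩, hag₀⟩ := h0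
  -- All agreeing codewords lie in one coset of the image of the vanishing subspace.
  have hsub : {c | c ∈ (V.map (blockEncode G) : Set (Fin N × Fin n → k)) ∧ AgreesWith c y} ⊆
      (fun w => blockEncode G u₀ + blockEncode G w) ''
        (vanishingSubspace V G S : Set (Fin N → Fin n → k)) := by
    rintro _ ⟨⟨u, hu, rfl⟩, hag⟩
    refine ⟨u - u₀, mem_vanishingSubspace.2 ⟨V.sub_mem hu hu₀, fun p hp => ?_⟩, ?_⟩
    · have hp' := (Finset.mem_filter.1 hp).2
      have h1 : blockEncode G u₀ p = blockEncode G u p :=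
        Option.some_injective _ ((hag₀ p hp').symm.trans (hag p hp'))
      change blockEncode G (u - u₀) p = 0
      rw [map_sub, Pi.sub_apply, h1, sub_self]
    · simp
  calc _ ≤ _ := Set.encard_le_encard hsub
    _ ≤ _ := Set.encard_image_le _ _
    _ = ((Nat.card (vanishingSubspace V G S) : ℕ) : ℕ∞) := by
        rw [Set.encard, ENat.card_eq_coe_natCard]
        rfl
    _ ≤ L := by
        rw [Nat.card_eq_fintype_card, Module.card_eq_pow_finrank (K := k)]
        exact_mod_cast (Nat.pow_le_pow_right Fintype.card_pos hfin).trans hL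

variable {k F : Type*} [Field k] [Field F] [Algebra k F]

/-- The folded Reed–Solomon encoding followed by an identification of the alphabet. -/
noncomputable def messageEncode {s n : ℕ} (γ : F) (N : ℕ) (φ : (Fin s → F) ≃ₗ[k] (Fin n → k)) :
    F[X] →ₗ[k] (Fin N → Fin n → k) :=
  LinearMap.pi fun i => φ.toLinearMap ∘ₗ (blockEval γ s i).restrictScalars k

theorem messageEncode_apply {s n : ℕ} (γ : F) (N : ℕ) (φ : (Fin s → F) ≃ₗ[k] (Fin n → k))
    (f : F[X]) (i : Fin N) : messageEncode γ N φ f i = φ (blockEval γ s i f) := rfl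

/-- The folded Reed–Solomon code as a linear code over the subfield `k`. -/
noncomputable def outerCode {s n : ℕ} (γ : F) (N K : ℕ) (φ : (Fin s → F) ≃ₗ[k] (Fin n → k)) :
    Submodule k (Fin N → Fin n → k) :=
  ((degreeLT F (s * K)).restrictScalars k).map (messageEncode γ N φ)

theorem concatCode_foldedRSCode {s n : ℕ} (γ : F) (N K : ℕ) (φ : (Fin s → F) ≃ₗ[k] (Fin n → k))
    (G : Fin N → Matrix (Fin n) (Fin n) k) :
    concatCode (foldedRSCode γ s N (s * K)) (fun i => innerEncoder φ (G i)) =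
      ((outerCode γ N K φ).map (blockEncode G) : Set (Fin N × Fin n → k)) := by
  ext c
  constructor
  · rintro ⟨_, ⟨f, hf, rfl⟩, rfl⟩
    exact ⟨messageEncode γ N φ f, ⟨f, mem_degreeLT.2 hf, rfl⟩, rfl⟩
  · rintro ⟨_, ⟨f, hf, rfl⟩, rfl⟩
    exact ⟨_, ⟨f, mem_degreeLT.1 hf, rfl⟩, rfl⟩

theorem hasZeroBound_outerCode {s n m N K : ℕ} {γ : F} (hγ : IsPrimitiveRoot γ m)
    (hsN : s * N ≤ m) (φ : (Fin s → F) ≃ₗ[k] (Fin n → k)) :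
    HasZeroBound (outerCode γ N K φ) K := by
  rintro _ ⟨f, hf, rfl⟩ T hT h
  rw [eq_zero_of_blockEval_eq_zero hγ hsN (mem_degreeLT.1 hf) T hT fun i hi =>
    φ.map_eq_zero_iff.1 (h i hi), map_zero]

/-- F^s contains k^s. This is how a lower bound on `s` forces `n` to be large. -/
theorem le_of_linearEquiv [Finite F] {s n : ℕ} (φ : (Fin s → F) ≃ₗ[k] (Fin n → k)) : s ≤ n := by
  have h : Function.Injective
      ((φ : (Fin s → F) →ₗ[k] (Fin n → k)) ∘ₗ (Algebra.linearMap k F).compLeft (Fin s)) :=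
    φ.injective.comp fun a b hab => funext fun i =>
      (algebraMap k F).injective (congrFun hab i)
  simpa using LinearMap.finrank_le_finrank_of_injective h

theorem card_outerCode [Fintype k] [Fintype F] {s n m N K : ℕ} {γ : F} (hγ : IsPrimitiveRoot γ m)
    (hsN : s * N ≤ m) (hKN : K ≤ N) (φ : (Fin s → F) ≃ₗ[k] (Fin n → k)) :
    Nat.card (outerCode γ N K φ) = Fintype.card k ^ (n * K) := by
  have hinj : Set.InjOn (messageEncode γ N φ) (degreeLT F (s * K) : Set F[X]) := by
    intro f hf g hg hfg
    refine sub_eq_zero.1 (eq_zero_of_blockEval_eq_zero hγ hsN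
      (mem_degreeLT.1 (Submodule.sub_mem _ hf hg)) Finset.univ (by simpa using hKN) fun i _ => ?_)
    have := congrFun hfg i
    rw [messageEncode_apply, messageEncode_apply] at this
    rw [map_sub, φ.injective this, sub_self]
  have hφ : Fintype.card F ^ s = Fintype.card k ^ n := by
    simpa using Fintype.card_congr φ.toEquiv
  calc Nat.card (outerCode γ N K φ)
      = (messageEncode γ N φ '' (degreeLT F (s * K) : Set F[X])).ncard := rfl
    _ = (degreeLT F (s * K) : Set F[X]).ncard := hinj.ncard_image
    _ = Nat.card (degreeLT F (s * K)) := rfl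
    _ = _ := by
        rw [Nat.card_congr (degreeLTEquiv F (s * K)).toEquiv, Nat.card_eq_fintype_card,
          Fintype.card_fun, Fintype.card_fin, pow_mul, hφ, pow_mul]

theorem exists_lowRank_finset [Fintype k] [Fintype F] {s n m N K r M : ℕ} {γ : F}
    (hγ : IsPrimitiveRoot γ m) (hγ0 : γ ≠ 0) (hsN : s * N ≤ m) (hKN : K ≤ N) (hM : 0 < M)
    (φ : (Fin s → F) ≃ₗ[k] (Fin n → k)) {W : Submodule k (Fin N → Fin n → k)}
    (hW : W ≤ outerCode γ N K φ) (hrank : r * M ≤ Module.finrank k W) :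
    ∃ B : Finset (Fin N), (B.card ≤ K ∨ B.card * (r - M) * (s - r) ≤ r * (s * K)) ∧
      ∀ i ∉ B, M ≤ Module.finrank k
        (W.map (LinearMap.proj (R := k) (φ := fun _ : Fin N => Fin n → k) i)) := by
  classical
  let W' : Submodule k F[X] :=
    (degreeLT F (s * K)).restrictScalars k ⊓ W.comap (messageEncode γ N φ)
  have hmap : W ≤ W'.map (messageEncode γ N φ) := by
    intro u hu
    obtain ⟨f, hf, rfl⟩ := hW hu
    exact ⟨f, ⟨hf, hu⟩, rfl⟩
  have : Finite (degreeLT F (s * K)) := Finite.of_equiv _ (degreeLTEquiv F (s * K)).toEquiv.symm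
  have : Finite W' := Finite.of_injective
    (fun f : W' => (⟨f.1, f.2.1⟩ : degreeLT F (s * K))) fun a b h =>
      Subtype.ext (Subtype.mk.inj h)
  have : FiniteDimensional k W' := Module.Finite.of_finite
  have hrank' : r * M ≤ Module.finrank k W' :=
    hrank.trans ((Submodule.finrank_mono hmap).trans (Submodule.finrank_map_le _ _))
  refine ⟨Finset.univ.filter fun i => Module.finrank k
    (W'.map ((blockEval γ s (i : ℕ)).restrictScalars k)) ≤ M,
    card_lowRank_blockEval (k := k) hγ hγ0 hsN hKN hM W' (fun f hf => mem_degreeLT.1 hf.1) hrank' _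
      fun i hi => (Finset.mem_filter.1 hi).2, fun i hi => ?_⟩
  have hi' : M < Module.finrank k (W'.map ((blockEval γ s (i : ℕ)).restrictScalars k)) := by
    simpa using hi
  refine hi'.le.trans ?_
  rw [← LinearEquiv.finrank_map_eq φ]
  refine Submodule.finrank_mono ?_
  rintro _ ⟨_, ⟨f, hf, rfl⟩, rfl⟩
  exact ⟨messageEncode γ N φ f, hf.2, rfl⟩

end Concatenation

/-! ### Choice of parameters -/

section Parameters

theorem le_sub_mul_one_add {a b δ : ℝ} (hδ : 0 < δ) (h : b * (1 + 1 / δ) ≤ a) :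
    a ≤ (a - b) * (1 + δ) := by
  have h1 := mul_le_mul_of_nonneg_right h hδ.le
  have h2 : b * (1 + 1 / δ) * δ = b * (δ + 1) := by field_simp
  nlinarith

/-- The choice of the rank parameters `M`, `r` and of the folding parameter. -/
theorem exists_rank_parameters (q J : ℕ) (hq : 2 ≤ q) {δ : ℝ} (hδ : 0 < δ) (hδ1 : δ ≤ 1) :
    ∃ M r s₀ : ℕ, 0 < M ∧ (q : ℝ) ^ J / (q : ℝ) ^ M ≤ δ ∧
      ∀ s K b : ℕ, s₀ ≤ s → b * (r - M) * (s - r) ≤ r * (s * K) → (b : ℝ) ≤ (1 + δ) * K := by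
  obtain ⟨m, hm⟩ := exists_pow_lt_of_lt_one hδ (by norm_num : (1 / 2 : ℝ) < 1)
  have hq2 : (2 : ℝ) ≤ q := by exact_mod_cast hq
  have hq0 : (0 : ℝ) < q := by linarith
  set M := J + m + 1 with hMdef
  -- With r ≥ M(1+1/η) and s ≥ r(1+1/η), the ratios r/(r−M) and s/(s−r) are each at most 1+η, and
  -- (1+η)² ≤ 1+δ because δ ≤ 1.
  set η := δ / 3 with hη
  have hη0 : 0 < η := by positivity
  obtain ⟨r, hr⟩ := exists_nat_ge ((M : ℝ) * (1 + 1 / η))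
  obtain ⟨s₀, hs₀⟩ := exists_nat_ge ((r : ℝ) * (1 + 1 / η))
  have hinv : 0 < 1 / η := by positivity
  have hM0 : (0 : ℝ) < M := by rw [hMdef]; positivity
  have hMr : (M : ℝ) < r := by nlinarith
  refine ⟨M, r, s₀, Nat.succ_pos _, ?_, ?_⟩
  · rw [div_le_iff₀ (by positivity), hMdef, add_assoc, pow_add]
    have h1 : 1 ≤ δ * (q : ℝ) ^ (m + 1) := by
      calc (1 : ℝ) = (1 / 2) ^ m * 2 ^ m := by rw [← mul_pow]; norm_num
        _ ≤ δ * (q : ℝ) ^ m :=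
          mul_le_mul hm.le (pow_le_pow_left₀ (by norm_num) hq2 m) (by positivity) hδ.le
        _ ≤ δ * (q : ℝ) ^ (m + 1) := by
          refine mul_le_mul_of_nonneg_left ?_ hδ.le
          exact pow_le_pow_right₀ (by linarith) (Nat.le_succ m)
    have h2 : (0 : ℝ) < (q : ℝ) ^ J := by positivity
    nlinarith
  · intro s K b hs hb
    have hs' : (r : ℝ) * (1 + 1 / η) ≤ s := hs₀.trans (by exact_mod_cast hs)
    have hrs : (r : ℝ) < s := by nlinarith
    have h1 := le_sub_mul_one_add hη0 hr
    have h2 := le_sub_mul_one_add hη0 hs'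
    have hb' : (b : ℝ) * (r - M) * (s - r) ≤ r * (s * K) := by
      rw [← Nat.cast_sub (by exact_mod_cast hMr.le), ← Nat.cast_sub (by exact_mod_cast hrs.le)]
      exact_mod_cast hb
    have hP : 0 < ((r : ℝ) - M) * (s - r) := mul_pos (sub_pos.2 hMr) (sub_pos.2 hrs)
    have h3 : (r : ℝ) * s ≤ ((r : ℝ) - M) * (s - r) * (1 + δ) := by
      calc (r : ℝ) * s ≤ ((r - M) * (1 + η)) * ((s - r) * (1 + η)) :=
            mul_le_mul h1 h2 (by positivity) (by nlinarith)
        _ = ((r : ℝ) - M) * (s - r) * ((1 + η) * (1 + η)) := by ring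
        _ ≤ _ := mul_le_mul_of_nonneg_left (by rw [hη]; nlinarith) hP.le
    have hK : (0 : ℝ) ≤ K := by positivity
    have h4 : ((r : ℝ) - M) * (s - r) * b ≤ ((r : ℝ) - M) * (s - r) * ((1 + δ) * K) := by
      nlinarith [mul_le_mul_of_nonneg_right h3 hK]
    exact le_of_mul_le_mul_left h4 hP

theorem exists_le_floor_rpow (D : ℕ) {ε e : ℝ} (hε : 0 < ε) (he : 0 < e) :
    ∃ N₀ : ℕ, ∀ N : ℕ, N₀ ≤ N → D ≤ ⌊((N : ℝ) / ε ^ 2) ^ e⌋₊ := by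
  have h : Filter.Tendsto (fun N : ℕ => ((N : ℝ) / ε ^ 2) ^ e) Filter.atTop Filter.atTop :=
    (tendsto_rpow_atTop he).comp
      (tendsto_natCast_atTop_atTop.atTop_div_const (by positivity))
  obtain ⟨N₀, hN₀⟩ := Filter.eventually_atTop.1 (h.eventually_ge_atTop (D : ℝ))
  exact ⟨N₀, fun N hN => Nat.le_floor (hN₀ N hN)⟩

theorem card_le_blockWeight_add {N n : ℕ} (S : Finset (Fin N × Fin n)) (A : Finset (Fin N)) :
    S.card ≤ blockWeight S A + n * Aᶜ.card := by
  classical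
  rw [← Finset.card_filter_add_card_filter_not (s := S) fun p => p.1 ∈ A, blockWeight]
  refine Nat.add_le_add_left ?_ _
  calc _ ≤ (Aᶜ ×ˢ (Finset.univ : Finset (Fin n))).card := by
        refine Finset.card_le_card fun p hp => ?_
        simpa using (Finset.mem_filter.1 hp).2
    _ = n * Aᶜ.card := by rw [Finset.card_product, Finset.card_univ, Fintype.card_fin, mul_comm]

end Parameters

/-! ### Probability estimates -/

section MainTheorem

variable {k F : Type*} [Field k] [Fintype k] [Field F] [Fintype F] [Algebra k F]

/-- For a fixed large set `S` of unerased positions, few tuples of inner codes have a large space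
of codewords vanishing on `S`. -/
theorem ncard_large_vanishingSubspace_le {s n m N K r M J : ℕ} {γ : F} {R ε : ℝ}
    (hγ : IsPrimitiveRoot γ m) (hγ0 : γ ≠ 0) (hsN : s * N ≤ m) (hKN : K ≤ N) (hM : 0 < M)
    (hε : 0 < ε) (hK : (K : ℝ) = R * N) (φ : (Fin s → F) ≃ₗ[k] (Fin n → k))
    (hqM : (Fintype.card k : ℝ) ^ J / (Fintype.card k : ℝ) ^ M ≤ ε / 4)
    (hdesign : ∀ b : ℕ, b * (r - M) * (s - r) ≤ r * (s * K) → (b : ℝ) ≤ (1 + ε / 4) * K)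
    (S : Finset (Fin N × Fin n)) (hS : (R + ε) * (n * N) ≤ S.card) :
    ({G | r * M < Module.finrank k (vanishingSubspace (outerCode γ N K φ) G S)}.ncard : ℝ) ≤
      (Fintype.card k : ℝ) ^ (((N : ℝ) + J * N - ε / 2 * (n * N)) * (J + 1)) *
        Nat.card (Fin N → Matrix (Fin n) (Fin n) k) := by
  have hn0 : (0 : ℝ) ≤ n := by positivity
  have hN0 : (0 : ℝ) ≤ N := by positivity
  have hKN' : (K : ℝ) ≤ N := by exact_mod_cast hKN
  refine ncard_bad_le (hasZeroBound_outerCode hγ hsN φ) hKN S (τ := (R + ε / 2) * N) ?_ _ ?_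
  · intro A hA
    have h1 : (S.card : ℝ) ≤ blockWeight S A + n * Aᶜ.card := by
      exact_mod_cast card_le_blockWeight_add S A
    -- If the complement of `A` has at most `K` elements, its size cancels and leaves −εnN.
    -- Otherwise the truncated difference is zero and the threshold τ leaves −εnN/2.
    rcases le_total Aᶜ.card K with h | h
    · rw [Nat.cast_mul, Nat.cast_sub h, hK]
      nlinarith [mul_nonneg hε.le (mul_nonneg hn0 hN0)]
    · rw [Nat.sub_eq_zero_of_le h, mul_zero, Nat.cast_zero]
      nlinarith [mul_le_mul_of_nonneg_left hA hn0]
  · intro G hG P hP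
    obtain ⟨B, hB, hBM⟩ := exists_lowRank_finset hγ hγ0 hsN hKN hM φ
      (W := vanishingSubspace (outerCode γ N K φ) G S) inf_le_left (le_of_lt hG)
    obtain ⟨u, hu, hcard⟩ := exists_card_compl_freshPositions_le _ B hBM P hP
    obtain ⟨huV, huS⟩ := mem_vanishingSubspace.1 hu
    refine ⟨u, huV, hcard.trans ?_, huS⟩
    have hBc : (B.card : ℝ) ≤ (1 + ε / 4) * K := by
      rcases hB with h | h
      · have : (B.card : ℝ) ≤ K := by exact_mod_cast h
        have : (0 : ℝ) ≤ K := by positivity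
        nlinarith
      · exact hdesign _ h
    have h2 := mul_le_mul_of_nonneg_left hqM hN0
    -- The two error terms are (ε/4)K ≤ (ε/4)N from the low-rank positions and (ε/4)N from the
    -- averaging, which together give τ.
    nlinarith

theorem uniformProb_erasureListDecodable {s n m N K r M J L : ℕ} {γ : F} {R ε : ℝ}
    (hγ : IsPrimitiveRoot γ m) (hγ0 : γ ≠ 0) (hsN : s * N ≤ m) (hKN : K ≤ N) (hM : 0 < M)
    (hε : 0 < ε) (hK : (K : ℝ) = R * N) (φ : (Fin s → F) ≃ₗ[k] (Fin n → k))
    (hqM : (Fintype.card k : ℝ) ^ J / (Fintype.card k : ℝ) ^ M ≤ ε / 4)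
    (hdesign : ∀ b : ℕ, b * (r - M) * (s - r) ≤ r * (s * K) → (b : ℝ) ≤ (1 + ε / 4) * K)
    (hL : Fintype.card k ^ (r * M) ≤ L) (hJ : 6 ≤ ε * (J + 1)) (hn : (J + 1) ^ 2 ≤ n) :
    1 - (Fintype.card k : ℝ) ^ (-((n : ℝ) * N)) ≤
      uniformProb (fun G : Fin N → Matrix (Fin n) (Fin n) k =>
        ErasureListDecodable (1 - R - ε) L
          (concatCode (foldedRSCode γ s N (s * K)) (fun i => innerEncoder φ (G i)))) := by
  classical
  have hq2 : (2 : ℝ) ≤ Fintype.card k := by exact_mod_cast Fintype.one_lt_card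
  have hq0 : (0 : ℝ) < Fintype.card k := by linarith
  refine one_sub_le_uniformProb ?_
  let T : Finset (Finset (Fin N × Fin n)) :=
    Finset.univ.filter fun S => (R + ε) * (n * N) ≤ S.card
  let bad : Finset (Fin N × Fin n) → Set (Fin N → Matrix (Fin n) (Fin n) k) := fun S =>
    {G | r * M < Module.finrank k (vanishingSubspace (outerCode γ N K φ) G S)}
  have hcover : {G : Fin N → Matrix (Fin n) (Fin n) k | ¬ ErasureListDecodable (1 - R - ε) L
      (concatCode (foldedRSCode γ s N (s * K)) (fun i => innerEncoder φ (G i)))} ⊆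
      ⋃ S ∈ T, bad S := by
    intro G hG
    by_contra hcon
    refine hG ?_
    rw [concatCode_foldedRSCode]
    refine erasureListDecodable_of_finrank_le _ G hL fun S hS => ?_
    by_contra hlt
    refine hcon (Set.mem_biUnion (Finset.mem_coe.2 (Finset.mem_filter.2
      ⟨Finset.mem_univ S, ?_⟩)) (not_le.1 hlt))
    have : 1 - (1 - R - ε) = R + ε := by ring
    rwa [this] at hS
  set total : ℝ := (Nat.card (Fin N → Matrix (Fin n) (Fin n) k) : ℝ)
  have htot0 : 0 ≤ total := by positivity
  set β := (Fintype.card k : ℝ) ^ (((N : ℝ) + J * N - ε / 2 * (n * N)) * (J + 1)) with hβ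
  have hβ0 : 0 < β := Real.rpow_pos_of_pos hq0 _
  calc _ ≤ ∑ S ∈ T, ((bad S).ncard : ℝ) := by
        exact_mod_cast (Set.ncard_le_ncard hcover (Set.toFinite _)).trans
          (Finset.set_ncard_biUnion_le _ _)
    _ ≤ ∑ _S ∈ T, β * total := Finset.sum_le_sum fun S hS =>
        ncard_large_vanishingSubspace_le hγ hγ0 hsN hKN hM hε hK φ hqM hdesign S
          (Finset.mem_filter.1 hS).2
    _ ≤ (2 : ℝ) ^ (n * N) * (β * total) := by
        rw [Finset.sum_const, nsmul_eq_mul]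
        refine mul_le_mul_of_nonneg_right ?_ (by positivity)
        have := Finset.card_le_univ T
        rw [Fintype.card_finset, Fintype.card_prod, Fintype.card_fin, Fintype.card_fin,
          mul_comm N n] at this
        exact_mod_cast this
    _ ≤ (Fintype.card k : ℝ) ^ (n * N) * (β * total) :=
        mul_le_mul_of_nonneg_right (pow_le_pow_left₀ (by norm_num) hq2 _) (by positivity)
    _ = (Fintype.card k : ℝ) ^ ((n : ℝ) * N +
          ((N : ℝ) + J * N - ε / 2 * (n * N)) * (J + 1)) * total := by
        rw [Real.rpow_add hq0, ← hβ, mul_assoc, ← Real.rpow_natCast, Nat.cast_mul]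
    _ ≤ _ := by
        refine mul_le_mul_of_nonneg_right
          (Real.rpow_le_rpow_of_exponent_le (by linarith) ?_) htot0
        have hn' : ((J : ℝ) + 1) ^ 2 ≤ n := by exact_mod_cast hn
        have hN0 : (0 : ℝ) ≤ N := by positivity
        have hnN : (0 : ℝ) ≤ n * N := by positivity
        -- The exponent is nN + (J+1)²N − ε(J+1)nN/2 ≤ nN + nN − 3nN.
        nlinarith [mul_le_mul_of_nonneg_right hn' hN0, mul_le_mul_of_nonneg_right hJ hnN]

theorem uniformProb_codeRate {s n m N K : ℕ} {γ : F} {R : ℝ}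
    (hγ : IsPrimitiveRoot γ m) (hsN : s * N ≤ m) (hKN : K ≤ N) (hn : 0 < n) (hN : 0 < N)
    (hK : (K : ℝ) = R * N) (φ : (Fin s → F) ≃ₗ[k] (Fin n → k)) (hRn : 2 ≤ n * (1 - R)) :
    1 - (Fintype.card k : ℝ) ^ (-((1 - R) / 2 * n * N)) ≤
      uniformProb (fun G : Fin N → Matrix (Fin n) (Fin n) k =>
        codeRate (concatCode (foldedRSCode γ s N (s * K))
          (fun i => innerEncoder φ (G i))) = R) := by
  classical
  have hq2 : (2 : ℝ) ≤ Fintype.card k := by exact_mod_cast Fintype.one_lt_card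
  refine one_sub_le_uniformProb ?_
  let V := outerCode γ N K φ
  have hV : HasZeroBound V K := hasZeroBound_outerCode hγ hsN φ
  let bad : Set (Fin N → Matrix (Fin n) (Fin n) k) :=
    {G | ∃ u ∈ V, u ≠ 0 ∧ blockEncode G u = 0}
  have hcover : {G : Fin N → Matrix (Fin n) (Fin n) k | ¬ codeRate
      (concatCode (foldedRSCode γ s N (s * K)) (fun i => innerEncoder φ (G i))) = R} ⊆ bad := by
    intro G hG
    by_contra hcon
    refine hG ?_
    have hinj : Set.InjOn (blockEncode G) (V : Set (Fin N → Fin n → k)) := by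
      intro u hu v hv huv
      by_contra hne
      exact hcon ⟨u - v, V.sub_mem hu hv, sub_ne_zero.2 hne, by rw [map_sub, huv, sub_self]⟩
    have hcard : (concatCode (foldedRSCode γ s N (s * K))
        (fun i => innerEncoder φ (G i))).ncard = Fintype.card k ^ (n * K) := by
      rw [concatCode_foldedRSCode, Submodule.map_coe, hinj.ncard_image]
      exact card_outerCode hγ hsN hKN φ
    have hn' : (n : ℝ) ≠ 0 := by exact_mod_cast hn.ne'
    have hN' : (N : ℝ) ≠ 0 := by exact_mod_cast hN.ne'
    rw [codeRate, hcard, Nat.cast_pow, Real.logb_pow, Real.logb_self_eq_one (by linarith),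
      Fintype.card_prod, Fintype.card_fin, Fintype.card_fin]
    push_cast
    rw [hK]
    field_simp
  -- With J = 0 every `P i` is zero and one word is chosen: a nonzero codeword has at most K − 1
  -- zero positions, whence τ. The resulting exponent N − n(N−K) is controlled by n(1−R) ≥ 2.
  have hbad := ncard_bad_le (J := 0) hV hKN Finset.univ (τ := (K : ℝ) - 1)
    (x := n * ((N : ℝ) - K)) ?_ bad ?_
  · calc _ ≤ (bad.ncard : ℝ) := by exact_mod_cast Set.ncard_le_ncard hcover (Set.toFinite _)
      _ ≤ _ := hbad
      _ ≤ _ := by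
        refine mul_le_mul_of_nonneg_right
          (Real.rpow_le_rpow_of_exponent_le (by linarith) ?_) (by positivity)
        rw [hK, Nat.cast_zero]
        have hN0 : (0 : ℝ) ≤ N := by positivity
        nlinarith [mul_le_mul_of_nonneg_right hRn hN0]
  · intro A hA
    have h1 : Aᶜ.card ≤ K := by
      have : (Aᶜ.card : ℝ) ≤ K := by linarith
      exact_mod_cast this
    have h2 : (((Finset.univ : Finset (Fin N × Fin n)).card : ℕ) : ℝ) ≤
        blockWeight (Finset.univ : Finset (Fin N × Fin n)) A + n * Aᶜ.card := by
      exact_mod_cast card_le_blockWeight_add Finset.univ A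
    rw [Finset.card_univ, Fintype.card_prod, Fintype.card_fin, Fintype.card_fin] at h2
    rw [Nat.cast_mul, Nat.cast_sub h1]
    push_cast at h2
    nlinarith
  · rintro G ⟨u, hu, hu0, hGu⟩ P hP
    refine ⟨u, hu, ?_, fun p _ => congrFun hGu p⟩
    have hlt : (freshPositions P u)ᶜ.card < K := by
      by_contra hge
      refine hu0 (hV u hu _ (not_lt.1 hge) fun i hi => ?_)
      have hPi : P i = ⊥ := Submodule.finrank_eq_zero.1 (Nat.le_zero.1 (hP i))
      have : u i ∈ P i := by simpa [freshPositions] using hi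
      rwa [hPi, Submodule.mem_bot] at this
    have : ((freshPositions P u)ᶜ.card : ℝ) + 1 ≤ K := by exact_mod_cast hlt
    linarith

/-- The parameters that guarantee list decodability from erasures. -/
theorem exists_uniformProb_erasureListDecodable_ge (q : ℕ) (hq : IsPrimePow q) {R ε : ℝ}
    (hR0 : 0 < R) (hε : 0 < ε) :
    ∃ s₀ N₀ : ℕ, ∀ (s N K n : ℕ), s₀ ≤ s → N₀ ≤ N → (K : ℝ) = R * N → K ≤ N →
      ∀ (k : Type*) (F : Type*) [Field k] [Fintype k] [Field F] [Fintype F] [Algebra k F] (γ : F)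
        (φ : (Fin s → F) ≃ₗ[k] (Fin n → k)) (m : ℕ),
        Fintype.card k = q → s * N ≤ m → γ ≠ 0 → IsPrimitiveRoot γ m →
        1 - (q : ℝ) ^ (-((n : ℝ) * N)) ≤
          uniformProb (fun G : Fin N → Matrix (Fin n) (Fin n) k =>
            ErasureListDecodable (1 - R - ε)
              ⌊((N : ℝ) / ε ^ 2) ^ ((1 / ε ^ 2) * Real.log (1 / R))⌋₊
              (concatCode (foldedRSCode γ s N (s * K)) (fun i => innerEncoder φ (G i)))) := by
  have hq2 : 2 ≤ q := hq.two_le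
  -- A negative erasure fraction admits no received word. The remaining case forces R < 1, so the
  -- exponent of the list size is positive; this covers R = 1.
  by_cases hcase : 1 - R - ε < 0
  · refine ⟨1, 1, fun s N K n hs hN hK hKN k F _ _ _ _ _ γ φ m hkq _ _ _ => ?_⟩
    refine one_sub_le_uniformProb ?_
    have hempty : ∀ L : ℕ, {G : Fin N → Matrix (Fin n) (Fin n) k | ¬ ErasureListDecodable (1 - R - ε)
        L (concatCode (foldedRSCode γ s N (s * K)) (fun i => innerEncoder φ (G i)))} = ∅ := by
      refine fun L => Set.eq_empty_of_forall_notMem fun G hG => hG fun y hy => ?_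
      have hn : 0 < n := hs.trans (le_of_linearEquiv φ)
      have hpos : (0 : ℝ) < Fintype.card (Fin N × Fin n) := by
        rw [Fintype.card_prod, Fintype.card_fin, Fintype.card_fin]
        exact_mod_cast Nat.mul_pos hN hn
      have h1 := hy.trans_lt (mul_neg_of_neg_of_pos hcase hpos)
      exact absurd h1 (not_lt.2 (Nat.cast_nonneg _))
    rw [hempty, Set.ncard_empty, Nat.cast_zero]
    positivity
  · have hε1 : ε ≤ 1 := by linarith
    have hlog : 0 < Real.log (1 / R) :=
      Real.log_pos (by rw [lt_div_iff₀ hR0]; linarith)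
    obtain ⟨J, hJ⟩ := exists_nat_ge (6 / ε)
    obtain ⟨M, r, s₁, hM, hqM, hdes⟩ :=
      exists_rank_parameters q J hq2 (δ := ε / 4) (by positivity) (by linarith)
    -- The list size q^(rM) does not depend on `N`, so a large `N` absorbs it.
    obtain ⟨N₀, hN₀⟩ := exists_le_floor_rpow (q ^ (r * M)) hε
      (e := (1 / ε ^ 2) * Real.log (1 / R)) (by positivity)
    refine ⟨max s₁ ((J + 1) ^ 2), N₀,
      fun s N K n hs hN hK hKN k F _ _ _ _ _ γ φ m hkq hsN hγ0 hγ => ?_⟩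
    have hn : s ≤ n := le_of_linearEquiv φ
    rw [← hkq] at hqM ⊢
    refine uniformProb_erasureListDecodable hγ hγ0 hsN hKN hM hε hK φ hqM
      (fun b => hdes s K b ((le_max_left _ _).trans hs)) (by rw [hkq]; exact hN₀ N hN) ?_
      (((le_max_right _ _).trans hs).trans hn)
    rw [div_le_iff₀ hε] at hJ
    nlinarith

end MainTheorem

/-! ### Assembly with C = c = 1 -/

theorem mainTheorem3 :
    ∃ C c : ℝ, 0 < C ∧ 0 < c ∧
      ∀ (q : ℕ), IsPrimePow q → ∀ (R : ℚ), 0 < R → R ≤ 1 →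
      ∃ c' : ℝ, 0 < c' ∧ ∀ (ε : ℝ), 0 < ε →
      ∃ s₀ N₀ : ℕ, ∀ (s N K n : ℕ), s₀ ≤ s → N₀ ≤ N → (K : ℚ) = R * N →
      ∀ (Fq F : Type*) [Field Fq] [Fintype Fq] [Field F] [Fintype F] [Algebra Fq F] (γ : F)
        (φ : (Fin s → F) ≃ₗ[Fq] (Fin n → Fq)),
        Fintype.card Fq = q → s * N < Fintype.card F →
        IsPrimitiveRoot γ (Fintype.card F - 1) →
        1 - (q : ℝ) ^ (-(c * n * N)) ≤
            uniformProb (fun G : Fin N → Matrix (Fin n) (Fin n) Fq =>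
              ErasureListDecodable (1 - R - ε)
                ⌊((N : ℝ) / ε ^ 2) ^ (C * (1 / ε ^ 2) * Real.log (1 / R))⌋₊
                (concatCode (foldedRSCode γ s N (s * K)) (fun i => innerEncoder φ (G i)))) ∧
          (R < 1 →
            1 - (q : ℝ) ^ (-(c' * n * N)) ≤
              uniformProb (fun G : Fin N → Matrix (Fin n) (Fin n) Fq =>
                codeRate (concatCode (foldedRSCode γ s N (s * K))
                  (fun i => innerEncoder φ (G i))) = R)) := by
  refine ⟨1, 1, one_pos, one_pos, fun q hq R hR0 hR1 => ?_⟩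
  have hR0' : (0 : ℝ) < R := by exact_mod_cast hR0
  obtain ⟨c', hc', hc'R⟩ : ∃ c' : ℝ, 0 < c' ∧ (R < 1 → c' = (1 - R) / 2) := by
    by_cases h : R < 1
    · have : (R : ℝ) < 1 := by exact_mod_cast h
      exact ⟨(1 - R) / 2, by linarith, fun _ => rfl⟩
    · exact ⟨1, one_pos, fun h' => absurd h' h⟩
  refine ⟨c', hc', fun ε hε => ?_⟩
  obtain ⟨s₁, N₁, hmain⟩ := exists_uniformProb_erasureListDecodable_ge q hq hR0' hε
  -- This secures n(1−R) ≥ 2 when R < 1; for R = 1 the quotient is 0 by convention and imposes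
  -- nothing.
  obtain ⟨s₂, hs₂⟩ := exists_nat_ge (2 / (1 - R : ℝ))
  refine ⟨max 1 (max s₁ s₂), max 1 N₁, fun s N K n hs hN hK Fq F _ _ _ _ _ γ φ hq' hsN hγ => ?_⟩
  have hs1 : 1 ≤ s := (le_max_left _ _).trans hs
  have hN1 : 1 ≤ N := (le_max_left _ _).trans hN
  have hss₁ : s₁ ≤ s := ((le_max_left _ _).trans (le_max_right _ _)).trans hs
  have hss₂ : s₂ ≤ s := ((le_max_right _ _).trans (le_max_right _ _)).trans hs
  have hK' : (K : ℝ) = R * N := by exact_mod_cast hK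
  have hKN : K ≤ N := by
    have h : (K : ℚ) ≤ N := by
      rw [hK]
      exact mul_le_of_le_one_left (Nat.cast_nonneg N) hR1
    exact_mod_cast h
  have hsN' : s * N ≤ Fintype.card F - 1 := Nat.le_sub_one_of_lt hsN
  have hγ0 : γ ≠ 0 := hγ.ne_zero (by have := Nat.mul_pos hs1 hN1; omega)
  have hsn : s ≤ n := le_of_linearEquiv φ
  refine ⟨?_, fun hR => ?_⟩
  · have := hmain s N K n hss₁ ((le_max_right _ _).trans hN) hK' hKN Fq F γ φ _ hq' hsN' hγ0 hγ
    simpa only [one_mul] using this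
  · rw [hc'R hR, ← hq']
    have hR' : (0 : ℝ) < 1 - R := by
      have : (R : ℝ) < 1 := by exact_mod_cast hR
      linarith
    refine uniformProb_codeRate hγ hsN' hKN (hs1.trans hsn) hN1 hK' φ ?_
    rw [← div_le_iff₀ hR']
    exact hs₂.trans (by exact_mod_cast hss₂.trans hsn)
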